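/- Let $m\ge 0$, $T>0$, $\mu\in\mathbb{R}$, let $p^0=\sqrt{m^2+|p|^2}$ for $p=(p^1,p^2,p^3)\in\mathbb{R}^3$, let $f^{\rm eq}_p=e^{(\mu-p^0)/T}$, and let $\mathcal{H}=L^2(\mathbb{R}^3,f^{\rm eq}_p\,d^3p/(2\pi)^3)$ be the Hilbert space of complex perturbations $\phi_p$ of the equilibrium state $f^{\rm eq}$ of a relativistic gas, with inner product $(\phi,\psi)=\int \frac{d^3p}{(2\pi)^3} f^{\rm eq}_p\phi_p^*\psi_p$. Let $v^1$ be the bounded operator on $\mathcal{H}$ of multiplication by $p^1/p^0$. Let the linearised collision operator be a densely defined linear operator in $\mathcal{H}$ which is Hermitian, $(\phi,I\psi)^*=(\psi,I\phi)$, nonnegative, $(\phi,I\phi)\ge 0$, and such that $I\phi=0$ if and only if $\phi\in\mathrm{span}\{1,p^0,p^1,p^2,p^3\}$; denote by $I$ also its Friedrichs (self-adjoint) extension. Suppose that the non-hydrodynamic sector is gapped: for some $\tau_g\in(0,\infty)$, the spectrum of $I$ restricted to $\{1,p^0,p^1,p^2,p^3\}^\perp$ is contained in $\{\mathrm{Re}\,z\ge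 1/\tau_g\}$. For $\chi\in\mathbb{C}$ let $I(\chi)=I+\chi v^1$, with the domain of $I$. Then there are $R,\delta>0$ and five pairs $(\lambda_s,\phi_s)$, $s=1,\dots,5$, of functions $\lambda_s:\{|\chi|<R\}\to\mathbb{C}$ and $\phi_s:\{|\chi|<R\}\to\mathcal{H}$ that are analytic and are given on the whole disc $|\chi|<R$ by convergent power series $$\lambda_s(\chi)=\sum_{n\ge 1}c_{sn}\chi^n,\qquad \phi_s(\chi)=\sum_{n\ge 0}g_{sn}\chi^n ,$$ such that for every $|\chi|<R$: the vectors $\phi_1(\chi),\dots,\phi_5(\chi)$ are linearly independent and lie in the domain of $I$; $I(\chi)\phi_s(\chi)=\lambda_s(\chi)\phi_s(\chi)$ for each $s$; the part of the spectrum of $I(\chi)$ in $\{|z|<\delta\}$ is exactly $\{\lambda_1(\chi),\dots,\lambda_5(\chi)\}$; and for every $|z|<\delta$ the solutions $\psi$ of $I(\chi)\psi=z\psi$ are exactly the linear combinations of those $\phi_s(\chi)$ with $\lambda_s(\chi)=z$. Call a function $\omega:\mathbb{C}\to\mathbb{C}$ a hydrodynamic dispersion relation if it is continuous in a neighbourhood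 of $0$, $\omega(0)=0$, and $i\omega(k)$ is an eigenvalue of $I(ik)$ for all $k\in\mathbb{C}$ close to $0$. Then $\omega$ is a hydrodynamic dispersion relation if and only if, near $k=0$, it coincides with one of the functions $k\mapsto -i\lambda_s(ik)$; and for every hydrodynamic dispersion relation $\omega$ there is $r>0$ such that the Taylor series of $\omega$ at $0$ converges to $\omega(k)$ for all $|k|<r$, so its radius of convergence is nonzero. -/

import Mathlib

open MeasureTheory Filter Topology
open scoped ENNReal InnerProductSpace

noncomputable section

/-! ### Unbounded operators -/

namespace UnboundedOp

variable {E : Type*} [NormedAddCommGroup E] [InnerProductSpace ℂ E]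

/-- `z` is in the resolvent set of `T` if `T - z`, from the domain of `T` to the whole space, has a
bounded everywhere defined two-sided inverse `R`. -/
def resolventSet (T : E →ₗ.[ℂ] E) : Set ℂ :=
  {z | ∃ R : E →L[ℂ] E,
    (∀ y : E, ∃ h : R y ∈ T.domain, T ⟨R y, h⟩ - z • R y = y) ∧
    ∀ x : T.domain, R (T x - z • (x : E)) = x}

/-- The spectrum of a partially defined operator. -/
def spectrum (T : E →ₗ.[ℂ] E) : Set ℂ := (resolventSet T)ᶜ

/-- `z` is an eigenvalue of `T`. -/
def HasEigenvalue (T : E →ₗ.[ℂ] E) (z : ℂ) : Prop :=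
  ∃ x : T.domain, (x : E) ≠ 0 ∧ T x = z • (x : E)

/-- The operator `T + χ V`, with the domain of `T`, for a bounded operator `V`. -/
def perturb (T : E →ₗ.[ℂ] E) (V : E →L[ℂ] E) (χ : ℂ) : E →ₗ.[ℂ] E where
  domain := T.domain
  toFun := T.toFun + χ • V.toLinearMap.comp T.domain.subtype

theorem perturb_apply (T : E →ₗ.[ℂ] E) (V : E →L[ℂ] E) (χ : ℂ) (x : T.domain) :
    perturb T V χ x = T x + χ • V (x : E) := rfl

/-- The part of `T` in the subspace `K`: its domain consists of the `x` in `K` that lie in the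
domain of `T` and satisfy `T x ∈ K`. -/
def part (T : E →ₗ.[ℂ] E) (K : Submodule ℂ E) : K →ₗ.[ℂ] K where
  domain :=
    { carrier := {x | ∃ h : (x : E) ∈ T.domain, T ⟨x, h⟩ ∈ K}
      zero_mem' := ⟨T.domain.zero_mem, by
        have : T ⟨0, T.domain.zero_mem⟩ = 0 := T.map_zero
        simp only [Submodule.coe_zero, this, K.zero_mem]⟩
      add_mem' := by
        rintro x y ⟨hx, hx'⟩ ⟨hy, hy'⟩
        refine ⟨T.domain.add_mem hx hy, ?_⟩
        have := T.map_add ⟨x, hx⟩ ⟨y, hy⟩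
        exact this ▸ K.add_mem hx' hy'
      smul_mem' := by
        rintro c x ⟨hx, hx'⟩
        refine ⟨T.domain.smul_mem c hx, ?_⟩
        have := T.map_smul c ⟨x, hx⟩
        exact this ▸ K.smul_mem c hx' }
  toFun :=
    { toFun := fun x => ⟨T ⟨x.1, x.2.1⟩, x.2.2⟩
      map_add' := fun x y => Subtype.ext (T.map_add ⟨x.1, x.2.1⟩ ⟨y.1, y.2.1⟩)
      map_smul' := fun c x => Subtype.ext (T.map_smul c ⟨x.1, x.2.1⟩) }

/-- The quadratic form `(x, A x)`. -/
def quadForm (A : E →ₗ.[ℂ] E) (x : A.domain) : ℝ := (⟪(x : E), A x⟫_ℂ).re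

theorem quadForm_add_le (A : E →ₗ.[ℂ] E) (h : ∀ x, 0 ≤ quadForm A x) (x y : A.domain) :
    quadForm A (x + y) ≤ 2 * quadForm A x + 2 * quadForm A y := by
  have h1 := h (x - y)
  unfold quadForm at *
  simp only [LinearPMap.map_sub, LinearPMap.map_add, Submodule.coe_add, Submodule.coe_sub,
    inner_add_left, inner_add_right, inner_sub_left, inner_sub_right, Complex.add_re,
    Complex.sub_re] at *
  linarith

theorem quadForm_smul (A : E →ₗ.[ℂ] E) (c : ℂ) (x : A.domain) :
    quadForm A (c • x) = ‖c‖ ^ 2 * quadForm A x := by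
  unfold quadForm
  rw [LinearPMap.map_smul, Submodule.coe_smul, inner_smul_left, inner_smul_right, ← mul_assoc,
    Complex.conj_mul', ← Complex.ofReal_pow, Complex.re_ofReal_mul]

/-- The domain of the closure of the quadratic form of `A`: the limits of sequences in the domain of
`A` that are Cauchy with respect to the form. -/
def formDomain (A : E →ₗ.[ℂ] E) (h : ∀ x, 0 ≤ quadForm A x) : Submodule ℂ E where
  carrier := {x | ∃ u : ℕ → A.domain, Tendsto (fun n => (u n : E)) atTop (𝓝 x) ∧
    Tendsto (fun p : ℕ × ℕ => quadForm A (u p.1 - u p.2)) atTop (𝓝 0)}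
  zero_mem' := ⟨fun _ => 0, by simp, by simp [quadForm]⟩
  add_mem' := by
    rintro x y ⟨u, hu, hu'⟩ ⟨v, hv, hv'⟩
    refine ⟨fun n => u n + v n, by simpa using hu.add hv, ?_⟩
    refine squeeze_zero (fun p => h _) (fun p => ?_)
      (by simpa using (hu'.const_mul 2).add (hv'.const_mul 2))
    rw [add_sub_add_comm]
    exact quadForm_add_le A h _ _
  smul_mem' := by
    rintro c x ⟨u, hu, hu'⟩
    refine ⟨fun n => c • u n, by simpa using hu.const_smul c, ?_⟩
    simp_rw [← smul_sub, quadForm_smul]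
    simpa using hu'.const_mul (‖c‖ ^ 2)

/-- The Friedrichs extension of a densely defined Hermitian nonnegative operator `A`: the
restriction of the adjoint of `A` to the domain of the closed form of `A`. -/
def friedrichs [CompleteSpace E] (A : E →ₗ.[ℂ] E) (h : ∀ x, 0 ≤ quadForm A x) : E →ₗ.[ℂ] E :=
  A.adjoint.domRestrict (formDomain A h)

end UnboundedOp

/-! ### Relativistic kinetic theory linearised about a uniform equilibrium -/

/-- The particle mass, and the temperature and chemical potential of the reference state. -/
structure EquilibriumState where
  mass : ℝ
  temp : ℝ
  chemPot : ℝ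
  mass_nonneg : 0 ≤ mass
  temp_pos : 0 < temp

namespace EquilibriumState

/-- Momentum space. The coordinates `p 0`, `p 1`, `p 2` are the components of the momentum along the
directions 1, 2, 3. -/
abbrev Momentum : Type := EuclideanSpace ℝ (Fin 3)

variable (S : EquilibriumState)

/-- The energy `p⁰`. -/
def energy (p : Momentum) : ℝ := Real.sqrt (S.mass ^ 2 + ‖p‖ ^ 2)

/-- The equilibrium distribution `exp ((μ - p⁰) / T)`. -/
def feq (p : Momentum) : ℝ := Real.exp ((S.chemPot - S.energy p) / S.temp)

/-- The measure `feq d³p / (2π)³`. -/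
def measure : Measure Momentum :=
  volume.withDensity fun p => ENNReal.ofReal (S.feq p / (2 * Real.pi) ^ 3)

/-- The Hilbert space of the perturbations `φ`. -/
abbrev H : Type := Lp ℂ 2 S.measure

/-- The functions `1, p⁰, p¹, p², p³`. -/
def invariantFun (i : Fin 5) (p : Momentum) : ℂ :=
  (![1, S.energy p, p 0, p 1, p 2] i : ℝ)

theorem continuous_energy : Continuous S.energy := by
  unfold energy; fun_prop

theorem norm_le_energy (p : Momentum) : ‖p‖ ≤ S.energy p :=
  Real.le_sqrt_of_sq_le (by nlinarith [sq_nonneg S.mass])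

theorem energy_le (p : Momentum) : S.energy p ≤ S.mass + ‖p‖ := by
  have := S.mass_nonneg
  exact Real.sqrt_le_iff.2
    ⟨by positivity, by nlinarith [norm_nonneg p, mul_nonneg this (norm_nonneg p)]⟩

theorem continuous_invariantFun (i : Fin 5) : Continuous (S.invariantFun i) := by
  have := S.continuous_energy
  unfold invariantFun
  refine Complex.continuous_ofReal.comp ?_
  fin_cases i <;> simp <;> fun_prop

theorem norm_invariantFun_le (i : Fin 5) (p : Momentum) :
    ‖S.invariantFun i p‖ ≤ 1 + S.mass + ‖p‖ := by
  have hm := S.mass_nonneg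
  have hp := norm_nonneg p
  have h0 : ∀ j, |p j| ≤ ‖p‖ := fun j => by simpa using PiLp.norm_apply_le p j
  have he : |S.energy p| ≤ S.mass + ‖p‖ := by
    rw [abs_of_nonneg (show 0 ≤ S.energy p from Real.sqrt_nonneg _)]; exact S.energy_le p
  rw [invariantFun, Complex.norm_real, Real.norm_eq_abs]
  fin_cases i
  · simp; linarith
  · simp; linarith
  · simp; linarith [h0 0]
  · simp; linarith [h0 1]
  · simp; linarith [h0 2]

theorem integrable_exp_neg_norm {b : ℝ} (hb : 0 < b) :
    Integrable (fun p : Momentum => Real.exp (-b * ‖p‖)) := by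
  refine (integrable_fun_norm_addHaar volume (f := fun r => Real.exp (-b * r))).2 ?_
  have := integrableOn_rpow_mul_exp_neg_mul_rpow (p := 1) (s := 2) (b := b)
    (by norm_num) one_pos hb
  simpa using this

/-- The collision invariants are square integrable. -/
theorem memLp_invariantFun (i : Fin 5) : MemLp (S.invariantFun i) 2 S.measure := by
  have hT := S.temp_pos
  have hcf : Continuous S.feq := by
    have := S.continuous_energy
    unfold feq; fun_prop
  refine (memLp_two_iff_integrable_sq_norm
    (S.continuous_invariantFun i).aestronglyMeasurable).2 ?_
  rw [measure, integrable_withDensity_iff (by fun_prop) (by simp)]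
  set C : ℝ := 16 * S.temp ^ 2 * Real.exp ((1 + S.mass) / (2 * S.temp) + S.chemPot / S.temp) /
    (2 * Real.pi) ^ 3
  refine ((integrable_exp_neg_norm (b := 1 / (2 * S.temp)) (by positivity)).const_mul C).mono'
    ?_ (ae_of_all _ fun p => ?_)
  · have := S.continuous_invariantFun i
    exact ((by fun_prop : Continuous fun p => ‖S.invariantFun i p‖ ^ 2).measurable.mul
      (by fun_prop)).aestronglyMeasurable
  have hf : 0 ≤ S.feq p := (Real.exp_pos _).le
  have hm := S.mass_nonneg
  rw [ENNReal.toReal_ofReal (by positivity), Real.norm_of_nonneg (by positivity)]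
  have h1 : ‖S.invariantFun i p‖ ^ 2 ≤
      16 * S.temp ^ 2 * Real.exp ((1 + S.mass + ‖p‖) / (2 * S.temp)) := by
    have h2 := Real.add_one_le_exp ((1 + S.mass + ‖p‖) / (4 * S.temp))
    have h3 : 1 + S.mass + ‖p‖ ≤ 4 * S.temp * Real.exp ((1 + S.mass + ‖p‖) / (4 * S.temp)) := by
      have : 4 * S.temp * ((1 + S.mass + ‖p‖) / (4 * S.temp)) = 1 + S.mass + ‖p‖ := by
        field_simp
      nlinarith
    calc ‖S.invariantFun i p‖ ^ 2
        ≤ (4 * S.temp * Real.exp ((1 + S.mass + ‖p‖) / (4 * S.temp))) ^ 2 := by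
          gcongr; exact (S.norm_invariantFun_le i p).trans h3
      _ = _ := by
          rw [mul_pow, ← Real.exp_nat_mul]
          congr 1
          · ring
          · congr 1; field_simp; norm_num
  have h4 : S.feq p ≤ Real.exp ((S.chemPot - ‖p‖) / S.temp) := by
    unfold feq; gcongr; exact S.norm_le_energy p
  calc ‖S.invariantFun i p‖ ^ 2 * (S.feq p / (2 * Real.pi) ^ 3)
      ≤ (16 * S.temp ^ 2 * Real.exp ((1 + S.mass + ‖p‖) / (2 * S.temp))) *
        (Real.exp ((S.chemPot - ‖p‖) / S.temp) / (2 * Real.pi) ^ 3) := by gcongr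
    _ = 16 * S.temp ^ 2 * (Real.exp ((1 + S.mass + ‖p‖) / (2 * S.temp)) *
        Real.exp ((S.chemPot - ‖p‖) / S.temp)) / (2 * Real.pi) ^ 3 := by ring
    _ = 16 * S.temp ^ 2 * (Real.exp ((1 + S.mass) / (2 * S.temp) + S.chemPot / S.temp) *
        Real.exp (-(1 / (2 * S.temp)) * ‖p‖)) / (2 * Real.pi) ^ 3 := by
          rw [← Real.exp_add, ← Real.exp_add]
          have : (1 + S.mass + ‖p‖) / (2 * S.temp) + (S.chemPot - ‖p‖) / S.temp =
              (1 + S.mass) / (2 * S.temp) + S.chemPot / S.temp +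
                -(1 / (2 * S.temp)) * ‖p‖ := by field_simp; ring
          rw [this]
    _ = C * Real.exp (-(1 / (2 * S.temp)) * ‖p‖) := by simp only [C]; ring

/-- The functions `1, p⁰, p¹, p², p³` as elements of the Hilbert space. -/
def invariant (i : Fin 5) : S.H := (S.memLp_invariantFun i).toLp _

/-- The hydrodynamic subspace `span {1, p^ν}`. -/
def hydroSpace : Submodule ℂ S.H := Submodule.span ℂ (Set.range S.invariant)

/-- The space of the non-hydrodynamic excitations, the orthogonal complement of `{1, p^ν}`. -/
def nonHydroSpace : Submodule ℂ S.H := S.hydroSpaceᗮ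

/-- The velocity `v¹ = p¹ / p⁰`. -/
def velocity (p : Momentum) : ℂ := (p 0 / S.energy p : ℝ)

theorem memLp_velocity : MemLp S.velocity ∞ S.measure := by
  have hm : Measurable S.velocity :=
    Complex.measurable_ofReal.comp
      ((by fun_prop : Continuous fun p : Momentum => p 0).measurable.div
        S.continuous_energy.measurable)
  refine memLp_top_of_bound hm.aestronglyMeasurable 1 (ae_of_all _ fun p => ?_)
  have h0 : |p 0| ≤ ‖p‖ := by simpa using PiLp.norm_apply_le p 0
  have hE : 0 ≤ S.energy p := Real.sqrt_nonneg _
  rw [velocity, Complex.norm_real, Real.norm_eq_abs, abs_div, abs_of_nonneg hE]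
  exact div_le_one_of_le₀ (h0.trans (S.norm_le_energy p)) hE

/-- The bounded operator of multiplication by `v¹`. -/
def velocityOp : S.H →L[ℂ] S.H :=
  (ContinuousLinearMap.mul ℂ ℂ).holderL S.measure ∞ 2 2 (S.memLp_velocity.toLp _)

theorem velocityOp_apply_ae (φ : S.H) :
    S.velocityOp φ =ᵐ[S.measure] fun p => S.velocity p * φ p := by
  have h1 := (ContinuousLinearMap.mul ℂ ℂ).coeFn_holder (r := 2) (S.memLp_velocity.toLp _) φ
  filter_upwards [h1, S.memLp_velocity.coeFn_toLp] with p hp hp'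
  rw [← hp']
  exact hp

/-- The assumptions on the linearised collision operator `I = -(p⁰)⁻¹ L`: it is a densely defined
operator, Hermitian and nonnegative, whose kernel is exactly `span {1, p^ν}`. -/
structure IsCollisionOperator (A : S.H →ₗ.[ℂ] S.H) : Prop where
  dense : Dense (A.domain : Set S.H)
  hermitian : ∀ φ ψ : A.domain, (starRingEnd ℂ) ⟪(φ : S.H), A ψ⟫_ℂ = ⟪(ψ : S.H), A φ⟫_ℂ
  nonneg : ∀ φ : A.domain, 0 ≤ UnboundedOp.quadForm A φ
  ker : ∀ φ : S.H, (∃ h : φ ∈ A.domain, A ⟨φ, h⟩ = 0) ↔ φ ∈ S.hydroSpace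

/-- `ω` is a hydrodynamic dispersion relation of the gas with (self-adjoint) collision operator `I`:
a branch, defined and continuous for `k` in a neighbourhood of `0` in `ℂ`, of frequencies with
`ω 0 = 0` such that `λ = i ω` is an eigenvalue of `I + χ v¹` at `χ = i k`. -/
structure IsHydrodynamicDispersion (I : S.H →ₗ.[ℂ] S.H) (ω : ℂ → ℂ) : Prop where
  continuousAt : ∀ᶠ k in 𝓝 0, ContinuousAt ω k
  zero : ω 0 = 0
  eigenvalue : ∀ᶠ k in 𝓝 0, UnboundedOp.HasEigenvalue
    (UnboundedOp.perturb I S.velocityOp (Complex.I * k)) (Complex.I * ω k)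

end EquilibriumState

end

/-!
The proof is the Rellich–Kato reduction process, carried out without Puiseux series.

The Friedrichs extension `I` is symmetric (`friedrichs_symm`), its kernel contains the
hydrodynamic space `N`, and the gap hypothesis at `z = 0` says that `I` has a bounded inverse on
`Nᗮ`. Hence there is a reduced inverse `Q` of `I` (`exists_isReducedInverse`), and for small `χ`
the operator `I + χ V` leaves invariant the graph of a small operator `X(χ)` from `N` to `Nᗮ`:
invariance is the Riccati equation `X = Q (X P χV (1 + X) - χV (1 + X))`, which the implicit
function theorem solves analytically in `χ` (`exists_analyticAt_riccati`). On the graph, `I + χ V`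
becomes the analytic family `K(χ) = P χV (1 + X(χ))` of operators on the five-dimensional space
`N`. A Neumann series shows that off the graph `I + χ V - z` is invertible for `|z| < δ`, so that
eigenvectors and resolvent of `I + χ V` near `z = 0` are those of `K(χ)`
(`eq_graph_of_apply_eq_smul`, `exists_rightInverse`).

For real `χ`, `K(χ)` is symmetric for the inner product pulled back from the graph. A family with
this property has analytic eigenvalues and a basis of analytic eigenvectors
(`hasAnalyticDiagonalization`), by induction on the dimension: write `K(χ) = f(χ) + χ ^ m g(χ)`
with `f` scalar and either `g = 0` or `g(0)` not scalar. In the latter case `g(0)` splits the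
space into an eigenspace and a complement; two Riccati equations continue both to invariant
subspaces of `g(χ)`, analytically in `χ`, and the induction hypothesis applies to each. Since the
scalar part `f` need not be real on the real axis, the induction runs with families that are
symmetric up to a scalar (`IsSymmUpToScalar`).

Finally, two of the functions `k ↦ -i λ_s(ik)` either agree near `0` or differ at all `k ≠ 0`
close to `0`, and a punctured disc is connected, so a continuous branch of eigenvalues follows one
of them (`exists_eventuallyEq_of_continuous_selection`).
-/

/-! ### Analytic fixed points and the Riccati equations -/

/-- Implicit function theorem for `x = Φ (t, x)` where `Φ (0, ·)` vanishes, so that the partial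
derivative of `x - Φ (t, x)` in `x` at the origin is the identity. -/
theorem exists_analyticAt_fixedPoint {G : Type*} [NormedAddCommGroup G] [NormedSpace ℂ G]
    [CompleteSpace G] {Φ : ℂ × G → G} (hΦ : AnalyticAt ℂ Φ (0, 0)) (h0 : ∀ x, Φ (0, x) = 0) :
    ∃ x : ℂ → G, AnalyticAt ℂ x 0 ∧ x 0 = 0 ∧ ∀ᶠ t in 𝓝 0, x t = Φ (t, x t) := by
  have hF : AnalyticAt ℂ (fun u : ℂ × G => u.2 - Φ u) (0, 0) := analyticAt_snd.sub hΦ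
  have hinv : (fderiv ℂ (fun u : ℂ × G => u.2 - Φ u) (0, 0) ∘L .inr ℂ ℂ G).IsInvertible := by
    have h1 : HasFDerivAt (fun y : G => y - Φ (0, y))
        (fderiv ℂ (fun u : ℂ × G => u.2 - Φ u) (0, 0) ∘L .inr ℂ ℂ G) 0 :=
      hF.differentiableAt.hasFDerivAt.comp (0 : G) (hasFDerivAt_prodMk_right (0 : ℂ) (0 : G))
    simp only [h0, sub_zero] at h1
    rw [h1.unique (hasFDerivAt_id 0)]
    exact ContinuousLinearMap.isInvertible_equiv (f := .refl ℂ G)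
  have hω := hF.contDiffAt (n := ⊤)
  refine ⟨hω.implicitFunction (by simp) hinv, ?_, ?_, ?_⟩
  · exact (hω.contDiffAt_implicitFunction (by simp) hinv).analyticAt
  · exact hω.implicitFunction_apply_self (by simp) hinv
  · filter_upwards [hω.eventually_apply_implicitFunction (by simp) hinv] with t ht
    simpa [h0, sub_eq_zero] using ht

section Riccati

variable {𝒜 : Type*}

section Solution

variable [NormedRing 𝒜] [NormedAlgebra ℂ 𝒜] [CompleteSpace 𝒜]

/-- The equation for an operator `x` whose graph over the range of the projection `p` is invariant
under `d + b t`, where `s` is the reduced inverse of `d`; see `mul_graph_eq`. -/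
theorem exists_analyticAt_riccati (s p : 𝒜) {b : ℂ → 𝒜} (hb : AnalyticAt ℂ b 0) (hb0 : b 0 = 0) :
    ∃ x : ℂ → 𝒜, AnalyticAt ℂ x 0 ∧ x 0 = 0 ∧
      ∀ᶠ t in 𝓝 0, x t = s * (x t * p * b t * (1 + x t) - b t * (1 + x t)) := by
  have hb' : AnalyticAt ℂ (fun u : ℂ × 𝒜 => b u.1) (0, 0) :=
    hb.comp_of_eq analyticAt_fst rfl
  have hx : AnalyticAt ℂ (fun u : ℂ × 𝒜 => u.2) (0, 0) := analyticAt_snd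
  have h1 : AnalyticAt ℂ (fun u : ℂ × 𝒜 => 1 + u.2) (0, 0) := analyticAt_const.add hx
  exact exists_analyticAt_fixedPoint
    (Φ := fun u => s * (u.2 * p * b u.1 * (1 + u.2) - b u.1 * (1 + u.2)))
    (analyticAt_const.mul ((((hx.mul analyticAt_const).mul hb').mul h1).sub (hb'.mul h1)))
    (by simp [hb0])

/-- The equation for an operator `x` whose graph over the range of the complementary projection
`1 - p` is invariant under `d + b t`; see `mul_dualGraph_eq`. -/
theorem exists_analyticAt_dualRiccati (s p : 𝒜) {b : ℂ → 𝒜} (hb : AnalyticAt ℂ b 0)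
    (hb0 : b 0 = 0) :
    ∃ x : ℂ → 𝒜, AnalyticAt ℂ x 0 ∧ x 0 = 0 ∧
      ∀ᶠ t in 𝓝 0, x t = p * (b t * (1 + x t) - x t * (1 - p) * b t * (1 + x t)) * s := by
  have hb' : AnalyticAt ℂ (fun u : ℂ × 𝒜 => b u.1) (0, 0) :=
    hb.comp_of_eq analyticAt_fst rfl
  have hx : AnalyticAt ℂ (fun u : ℂ × 𝒜 => u.2) (0, 0) := analyticAt_snd
  have h1 : AnalyticAt ℂ (fun u : ℂ × 𝒜 => 1 + u.2) (0, 0) := analyticAt_const.add hx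
  exact exists_analyticAt_fixedPoint
    (Φ := fun u => p * (b u.1 * (1 + u.2) - u.2 * (1 - p) * b u.1 * (1 + u.2)) * s)
    ((analyticAt_const.mul ((hb'.mul h1).sub
      (((hx.mul analyticAt_const).mul hb').mul h1))).mul analyticAt_const)
    (by simp [hb0])

end Solution

variable [Ring 𝒜]

/-- The graph of `x` over the range of `p` is invariant under `d + b`, which acts on it as
`b * (1 + x)` compressed to the range of `p`. -/
theorem mul_graph_eq {d s p b x : 𝒜} (hdp : d * p = 0) (hds : d * s = 1 - p)
    (hps : p * s = 0)
    (hx : x = s * (x * p * b * (1 + x) - b * (1 + x))) :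
    (d + b) * ((1 + x) * p) = (1 + x) * p * (b * (1 + x) * p) := by
  have hpx : p * x = 0 := by rw [hx, ← mul_assoc, hps, zero_mul]
  have hdx : d * x = x * p * b * (1 + x) - (1 - p) * (b * (1 + x)) := by
    have : d * x = (1 - p) * (x * p * b * (1 + x) - b * (1 + x)) := by
      conv_lhs => rw [hx, ← mul_assoc, hds]
    rw [this, mul_sub]
    congr 1
    simp only [sub_mul, one_mul, ← mul_assoc, hpx, sub_zero]
  calc (d + b) * ((1 + x) * p) = d * p + d * x * p + b * (1 + x) * p := by noncomm_ring
    _ = _ := by rw [hdp, hdx]; noncomm_ring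

/-- The graph of `y` over the range of `1 - p` is invariant under `d + b`, which acts on it as
`d + b * (1 + y)` compressed to the range of `1 - p`. -/
theorem mul_dualGraph_eq {d s p b y : 𝒜} (hdp : d * p = 0) (hpd : p * d = 0) (hsd : s * d = 1 - p)
    (hsp : s * p = 0) (hp : p * p = p)
    (hy : y = p * (b * (1 + y) - y * (1 - p) * b * (1 + y)) * s) :
    (d + b) * ((1 + y) * (1 - p)) =
      (1 + y) * (1 - p) * ((d + b * (1 + y)) * (1 - p)) := by
  have hpy : p * y = y := by
    conv_lhs => rw [hy]
    conv_rhs => rw [hy]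
    simp only [← mul_assoc, hp]
  have hyp : y * p = 0 := by rw [hy, mul_assoc, hsp, mul_zero]
  have hyd : y * d = (p * (b * (1 + y)) - y * (1 - p) * b * (1 + y)) * (1 - p) := by
    have : y * d = p * (b * (1 + y) - y * (1 - p) * b * (1 + y)) * (1 - p) := by
      conv_lhs => rw [hy, mul_assoc, hsd]
    rw [this, mul_sub p]
    congr 2
    simp only [← mul_assoc, hpy]
  have hdy : d * y = 0 := by rw [← hpy, ← mul_assoc, hdp, zero_mul]
  calc (d + b) * ((1 + y) * (1 - p))
      = d - d * p + d * y * (1 - p) + b * (1 + y) * (1 - p) := by noncomm_ring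
    _ = d + b * (1 + y) * (1 - p) := by rw [hdp, hdy]; noncomm_ring
    _ = d - p * d - d * p + p * d * p + (y * d - y * p * d - y * (d * p) + y * (p * (d * p)))
        + (b * (1 + y) * (1 - p) - p * (b * (1 + y)) * (1 - p)
          + y * (1 - p) * b * (1 + y) * (1 - p)) := by
          rw [hdp, hpd, hyp, hyd]; noncomm_ring
    _ = _ := by noncomm_ring

end Riccati

section SymmUpToScalar

variable {E H : Type*} [NormedAddCommGroup E] [NormedSpace ℂ E]
  [NormedAddCommGroup H] [InnerProductSpace ℂ H]

/-- `K` is the sum of a scalar operator and an operator that is symmetric for the form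
`⟪W u, W v⟫`. This says that `⟪W u, W (K v)⟫ - ⟪W (K u), W v⟫` is a constant multiple of
`⟪W u, W v⟫`; the constant is eliminated by comparison with the vectors `u = v = x`, which makes the
condition closed in `W` and `K`. -/
def IsSymmUpToScalar (W : E →L[ℂ] H) (K : E →L[ℂ] E) : Prop :=
  ∀ x u v, ⟪W x, W x⟫_ℂ * (⟪W u, W (K v)⟫_ℂ - ⟪W (K u), W v⟫_ℂ) =
    (⟪W x, W (K x)⟫_ℂ - ⟪W (K x), W x⟫_ℂ) * ⟪W u, W v⟫_ℂ

namespace IsSymmUpToScalar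

variable {W : E →L[ℂ] H} {K : E →L[ℂ] E}

theorem of_symm (h : ∀ u v, ⟪W u, W (K v)⟫_ℂ = ⟪W (K u), W v⟫_ℂ) : IsSymmUpToScalar W K := by
  intro x u v
  rw [h, h, sub_self, sub_self, mul_zero, zero_mul]

theorem sub_smul_one (h : IsSymmUpToScalar W K) (c : ℂ) :
    IsSymmUpToScalar W (K - c • (1 : E →L[ℂ] E)) := by
  intro x u v
  have := h x u v
  simp only [_root_.sub_apply, _root_.smul_apply,
    one_apply_eq_self, map_sub, map_smul, inner_sub_left, inner_sub_right,
    inner_smul_left, inner_smul_right]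
  linear_combination this

theorem of_ofReal_smul {r : ℝ} (hr : r ≠ 0) (h : IsSymmUpToScalar W ((r : ℂ) • K)) :
    IsSymmUpToScalar W K := by
  intro x u v
  have := h x u v
  simp only [_root_.smul_apply, map_smul, inner_smul_left, inner_smul_right,
    Complex.conj_ofReal] at this
  have hr' : (r : ℂ) ≠ 0 := by exact_mod_cast hr
  apply mul_left_cancel₀ hr'
  linear_combination this

theorem comp {F : Type*} [NormedAddCommGroup F] [NormedSpace ℂ F] {j : F →L[ℂ] E}
    {K' : F →L[ℂ] F} (h : IsSymmUpToScalar W K) (hj : K ∘L j = j ∘L K') :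
    IsSymmUpToScalar (W ∘L j) K' := by
  intro x u v
  have hj' : ∀ y, j (K' y) = K (j y) := fun y => (DFunLike.congr_fun hj y).symm
  simp only [ContinuousLinearMap.comp_apply, hj']
  exact h _ _ _

theorem of_tendsto {α : Type*} {l : Filter α} [l.NeBot] {Wt : α → E →L[ℂ] H}
    {Kt : α → E →L[ℂ] E} (hW : Tendsto Wt l (𝓝 W)) (hK : Tendsto Kt l (𝓝 K))
    (h : ∀ᶠ t in l, IsSymmUpToScalar (Wt t) (Kt t)) : IsSymmUpToScalar W K := by
  intro x u v
  have hW' : ∀ y, Tendsto (fun t => Wt t y) l (𝓝 (W y)) := fun y =>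
    ((ContinuousLinearMap.apply ℂ H y).continuous.tendsto W).comp hW
  have hWK : ∀ y, Tendsto (fun t => Wt t (Kt t y)) l (𝓝 (W (K y))) := fun y =>
    (isBoundedBilinearMap_apply.continuous.tendsto (W, K y)).comp
      (hW.prodMk_nhds (((ContinuousLinearMap.apply ℂ E y).continuous.tendsto K).comp hK))
  refine tendsto_nhds_unique_of_eventuallyEq
    (((hW' x).inner (hW' x)).mul (((hW' u).inner (hWK v)).sub ((hWK u).inner (hW' v))))
    ((((hW' x).inner (hWK x)).sub ((hWK x).inner (hW' x))).mul ((hW' u).inner (hW' v))) ?_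
  filter_upwards [h] with t ht using ht x u v

/-- If `K` has a nonzero kernel vector, the scalar part of `K` is real. -/
theorem symm_of_apply_eq_zero (h : IsSymmUpToScalar W K) (hW : Function.Injective W) {x : E}
    (hx : x ≠ 0) (hKx : K x = 0) (u v : E) : ⟪W u, W (K v)⟫_ℂ = ⟪W (K u), W v⟫_ℂ := by
  have h1 := h x u v
  have h2 : W x ≠ 0 := fun h => hx (hW (by rw [h, map_zero]))
  simpa [hKx, h2, sub_eq_zero] using h1

theorem disjoint_ker_range (h : IsSymmUpToScalar W K) (hW : Function.Injective W) :
    Disjoint (LinearMap.ker (K : E →ₗ[ℂ] E)) (LinearMap.range (K : E →ₗ[ℂ] E)) := by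
  rw [Submodule.disjoint_def]
  rintro x hx ⟨y, rfl⟩
  by_contra hne
  have hx' : K (K y) = 0 := hx
  have := h.symm_of_apply_eq_zero hW hne hx' (K y) y
  rw [hx', map_zero, inner_zero_left, inner_self_eq_zero] at this
  exact hne (hW (by simpa using this))

end IsSymmUpToScalar

end SymmUpToScalar

/-! ### Diagonalization of analytic families in finite dimension -/

theorem AnalyticAt.clm_apply_of_clm {E F : Type*} [NormedAddCommGroup E] [NormedSpace ℂ E]
    [NormedAddCommGroup F] [NormedSpace ℂ F] {A : ℂ → E →L[ℂ] F} {e : ℂ → E} {z : ℂ}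
    (hA : AnalyticAt ℂ A z) (he : AnalyticAt ℂ e z) : AnalyticAt ℂ (fun t => A t (e t)) z :=
  AnalyticAt.comp₂ (h := fun q : (E →L[ℂ] F) × E => q.1 q.2)
    ((ContinuousLinearMap.id ℂ (E →L[ℂ] F)).analyticAt_bilinear (A z, e z)) hA he

section FiniteDimensional

variable {E : Type*} [NormedAddCommGroup E] [NormedSpace ℂ E]

/-- If the kernel and the range of `D` are disjoint, there are the projection `p` onto the kernel
along the range and the inverse `s` of `D` on the range, extended by zero to the kernel. -/
theorem exists_reducedResolvent [FiniteDimensional ℂ E] {D : E →L[ℂ] E}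
    (hD : Disjoint (LinearMap.ker (D : E →ₗ[ℂ] E)) (LinearMap.range (D : E →ₗ[ℂ] E))) :
    ∃ s p : E →L[ℂ] E, p * p = p ∧ D * p = 0 ∧ p * D = 0 ∧ D * s = 1 - p ∧ s * D = 1 - p ∧
      p * s = 0 ∧ s * p = 0 ∧ (∀ x, D x = 0 → p x = x) := by
  have hc : IsCompl (LinearMap.ker (D : E →ₗ[ℂ] E)) (LinearMap.range (D : E →ₗ[ℂ] E)) :=
    (Submodule.isCompl_iff_disjoint _ _
      (by rw [add_comm, LinearMap.finrank_range_add_finrank_ker])).2 hD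
  set p : E →L[ℂ] E := LinearMap.toContinuousLinearMap (Submodule.projection _ _ hc) with hp
  have hpmem : ∀ x, D (p x) = 0 := fun x => Submodule.projection_apply_mem hc x
  have hpfix : ∀ x, D x = 0 → p x = x := fun x hx =>
    Submodule.projection_apply_of_mem_left hc (x := x) hx
  have hpD : p * D = 0 := by
    ext x
    exact (Submodule.projection_apply_eq_zero_iff hc).2 ⟨x, rfl⟩
  have hDp : D * p = 0 := by ext x; exact hpmem x
  have hpp : p * p = p := by ext x; exact hpfix _ (hpmem x)
  -- Since `D p = p D = 0`, the inverse of `D` on its range is `(D + p)⁻¹ - p`.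
  have hinj : Function.Injective (D + p : E →L[ℂ] E) := by
    rw [injective_iff_map_eq_zero]
    intro x hx
    have hx' : D x + p x = 0 := hx
    have h1 : p x = 0 := by
      have h2 := congrArg p hx'
      have h3 : p (D x) = 0 := DFunLike.congr_fun hpD x
      have h4 : p (p x) = p x := DFunLike.congr_fun hpp x
      rwa [map_add, h3, h4, zero_add, map_zero] at h2
    have h2 : D x = 0 := by simpa [h1] using hx'
    rw [← hpfix x h2, h1]
  set F : E ≃L[ℂ] E := (LinearEquiv.ofInjectiveEndo ((D + p : E →L[ℂ] E) : E →ₗ[ℂ] E)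
    hinj).toContinuousLinearEquiv with hF
  have hFD : ((F : E →L[ℂ] E)) = D + p := by ext x; rfl
  set f : E →L[ℂ] E := (F.symm : E →L[ℂ] E) with hf
  have h1 : (D + p) * f = 1 := by rw [← hFD]; ext x; simp [hf]
  have h2 : f * (D + p) = 1 := by rw [← hFD]; ext x; simp [hf]
  have hpf : p * f = p := by
    calc p * f = (p * D + p * p) * f := by rw [hpD, hpp, zero_add]
      _ = p * ((D + p) * f) := by noncomm_ring
      _ = p := by rw [h1, mul_one]
  have hfp : f * p = p := by
    calc f * p = f * (D * p + p * p) := by rw [hDp, hpp, zero_add]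
      _ = f * (D + p) * p := by noncomm_ring
      _ = p := by rw [h2, one_mul]
  have hDf : D * f = 1 - p := by
    rw [eq_sub_iff_add_eq, ← h1, add_mul, hpf]
  have hfD : f * D = 1 - p := by
    rw [eq_sub_iff_add_eq, ← h2, mul_add, hfp]
  refine ⟨f - p, p, hpp, hDp, hpD, ?_, ?_, ?_, ?_, hpfix⟩
  · rw [mul_sub, hDf, hDp, sub_zero]
  · rw [sub_mul, hfD, hpD, sub_zero]
  · rw [mul_sub, hpf, hpp, sub_self]
  · rw [sub_mul, hfp, hpp, sub_self]

/-- Near `t = 0` the family `K` has `n` analytic eigenvectors which at `t = 0` are linearly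
independent and lie in `N`, with analytic eigenvalues. -/
def HasAnalyticEigenvectors (K : ℂ → E →L[ℂ] E) (N : Submodule ℂ E) (n : ℕ) : Prop :=
  ∃ (lam : Fin n → ℂ → ℂ) (e : Fin n → ℂ → E), (∀ i, AnalyticAt ℂ (lam i) 0) ∧
    (∀ i, AnalyticAt ℂ (e i) 0) ∧ LinearIndependent ℂ (fun i => e i 0) ∧ (∀ i, e i 0 ∈ N) ∧
    ∀ i, ∀ᶠ t in 𝓝 0, K t (e i t) = lam i t • e i t

namespace HasAnalyticEigenvectors

variable {K : ℂ → E →L[ℂ] E}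

theorem add {N₁ N₂ : Submodule ℂ E} {n₁ n₂ : ℕ} (h₁ : HasAnalyticEigenvectors K N₁ n₁)
    (h₂ : HasAnalyticEigenvectors K N₂ n₂) (h : Disjoint N₁ N₂) :
    HasAnalyticEigenvectors K ⊤ (n₁ + n₂) := by
  obtain ⟨l₁, e₁, hl₁, he₁, hi₁, hN₁, hK₁⟩ := h₁
  obtain ⟨l₂, e₂, hl₂, he₂, hi₂, hN₂, hK₂⟩ := h₂
  refine ⟨Fin.append l₁ l₂, Fin.append e₁ e₂, ?_, ?_, ?_, fun _ => Submodule.mem_top, ?_⟩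
  · exact fun i => Fin.addCases (by simpa using hl₁) (by simpa using hl₂) i
  · exact fun i => Fin.addCases (by simpa using he₁) (by simpa using he₂) i
  · have h3 : LinearIndependent ℂ (Sum.elim (fun i => e₁ i 0) (fun i => e₂ i 0)) :=
      hi₁.sum_type hi₂ (h.mono (Submodule.span_le.2 (by rintro _ ⟨i, rfl⟩; exact hN₁ i))
        (Submodule.span_le.2 (by rintro _ ⟨i, rfl⟩; exact hN₂ i)))
    rw [← linearIndependent_equiv finSumFinEquiv]
    convert h3 using 1
    funext i
    rcases i with i | i <;> simp
  · exact fun i => Fin.addCases (by simpa using hK₁) (by simpa using hK₂) i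

theorem scalar_add_pow_smul {g : ℂ → E →L[ℂ] E} {n : ℕ} {N : Submodule ℂ E}
    (h : HasAnalyticEigenvectors g N n) {f : ℂ → ℂ} (hf : AnalyticAt ℂ f 0) (c : ℂ) (m : ℕ)
    (hK : ∀ᶠ t in 𝓝 0, K t = f t • (1 : E →L[ℂ] E) + t ^ m • (g t + c • (1 : E →L[ℂ] E))) :
    HasAnalyticEigenvectors K N n := by
  obtain ⟨l, e, hl, he, hi, hN, hg⟩ := h
  refine ⟨fun i t => f t + t ^ m * (l i t + c), e, fun i => ?_, he, hi, hN, fun i => ?_⟩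
  · exact hf.add ((analyticAt_id.pow m).mul ((hl i).add analyticAt_const))
  · filter_upwards [hK, hg i] with t ht hgt
    rw [ht]
    simp only [_root_.add_apply, _root_.smul_apply, one_apply_eq_self, hgt]
    module

end HasAnalyticEigenvectors

theorem AnalyticAt.conj_clm {F : Type*} [NormedAddCommGroup F] [NormedSpace ℂ F]
    {F' : Type*} [NormedAddCommGroup F'] [NormedSpace ℂ F']
    {E' : Type*} [NormedAddCommGroup E'] [NormedSpace ℂ E']
    {B : ℂ → E →L[ℂ] F} {z : ℂ} (hB : AnalyticAt ℂ B z) (r : F →L[ℂ] F') (i : E' →L[ℂ] E) :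
    AnalyticAt ℂ (fun t => r ∘L B t ∘L i) z :=
  (((ContinuousLinearMap.compL ℂ E' F F' r).comp
    ((ContinuousLinearMap.compL ℂ E' E F).flip i)).analyticAt _).comp hB

variable {H : Type*} [NormedAddCommGroup H] [InnerProductSpace ℂ H]

/-- Every analytic family of operators on `E` that for real `t ≠ 0` is symmetric up to a scalar, for
a form `⟪W t u, W t v⟫` continuous at `0` and definite there, has analytic eigenvectors forming a
basis of `E` at `t = 0`. The form need only be continuous and enters at real points only, so
that complex conjugation does not spoil analyticity. -/
def HasAnalyticDiagonalization (E H : Type*) [NormedAddCommGroup E] [NormedSpace ℂ E]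
    [NormedAddCommGroup H] [InnerProductSpace ℂ H] : Prop :=
  ∀ (K : ℂ → E →L[ℂ] E) (W : ℂ → E →L[ℂ] H), AnalyticAt ℂ K 0 → ContinuousAt W 0 →
    Function.Injective (W 0) → (∀ᶠ t : ℝ in 𝓝[≠] 0, IsSymmUpToScalar (W t) (K t)) →
    HasAnalyticEigenvectors K ⊤ (Module.finrank ℂ E)

theorem tendsto_ofReal_punctured :
    Tendsto (fun t : ℝ => (t : ℂ)) (𝓝[≠] 0) (𝓝 0) := by
  have := Complex.continuous_ofReal.tendsto 0
  rw [Complex.ofReal_zero] at this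
  exact this.mono_left nhdsWithin_le_nhds

/-- If the image of `N` under `j t` is invariant under `K t`, then analytic diagonalization on `N`
yields eigenvectors of `K`. The restriction of `K` is transported to `N` by `j`, and so is the
form. -/
theorem hasAnalyticEigenvectors_of_graph {N : Submodule ℂ E}
    (hN : HasAnalyticDiagonalization N H) {K j B : ℂ → E →L[ℂ] E} {W : ℂ → E →L[ℂ] H}
    (hW : ContinuousAt W 0) (hWi : Function.Injective (W 0))
    (hsym : ∀ᶠ t : ℝ in 𝓝[≠] 0, IsSymmUpToScalar (W t) (K t))
    (hj : AnalyticAt ℂ j 0) (hj0 : j 0 = 1) (hB : AnalyticAt ℂ B 0) {π : E →L[ℂ] E}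
    (hπ : ∀ x, π x ∈ N) (hπN : ∀ x ∈ N, π x = x)
    (hK : ∀ᶠ t in 𝓝 0, K t * (j t * π) = j t * π * (B t * π)) :
    HasAnalyticEigenvectors K N (Module.finrank ℂ N) := by
  set r : E →L[ℂ] N := π.codRestrict N hπ with hr
  set KN : ℂ → N →L[ℂ] N := fun t => r ∘L B t ∘L N.subtypeL with hKN
  have hcomm : ∀ᶠ t in 𝓝 0, K t ∘L (j t ∘L N.subtypeL) = (j t ∘L N.subtypeL) ∘L KN t := by
    filter_upwards [hK] with t ht
    ext u
    have h1 : π (u : E) = u := hπN u u.2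
    have h2 := DFunLike.congr_fun ht (u : E)
    simpa [h1, hKN, hr] using h2
  obtain ⟨l, e, hl, he, hi, -, hKe⟩ := hN KN (fun t => W t ∘L (j t ∘L N.subtypeL))
    (hB.conj_clm r N.subtypeL)
    (hW.clm_comp (hj.continuousAt.clm_comp continuousAt_const))
    (by
      rw [hj0]
      exact hWi.comp Subtype.val_injective)
    (by
      filter_upwards [hsym, tendsto_ofReal_punctured.eventually hcomm] with t h1 h2
      exact h1.comp h2)
  refine ⟨l, fun i t => j t (e i t), hl, fun i => ?_, ?_, fun i => ?_, fun i => ?_⟩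
  · exact hj.clm_apply_of_clm ((N.subtypeL.analyticAt _).comp (he i))
  · simp only [hj0]
    exact hi.map' N.subtype N.ker_subtype
  · simp [hj0]
  · filter_upwards [hcomm, hKe i] with t h1 h2
    have h3 := DFunLike.congr_fun h1 (e i t)
    simp only [ContinuousLinearMap.comp_apply, h2, map_smul, Submodule.subtypeL_apply] at h3
    simpa using h3

/-- An analytic family of operators is scalar near `0`, or is a scalar family plus a power of `t`
times an analytic family whose value at `0` is not scalar. -/
theorem exists_scalar_add_pow_smul [Nontrivial E] {K : ℂ → E →L[ℂ] E} (hK : AnalyticAt ℂ K 0) :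
    ∃ f : ℂ → ℂ, AnalyticAt ℂ f 0 ∧ ((∀ᶠ t in 𝓝 0, K t = f t • (1 : E →L[ℂ] E)) ∨
      ∃ (m : ℕ) (g : ℂ → E →L[ℂ] E), AnalyticAt ℂ g 0 ∧ (∀ c : ℂ, g 0 ≠ c • 1) ∧
        ∀ᶠ t in 𝓝 0, K t = f t • (1 : E →L[ℂ] E) + t ^ m • g t) := by
  -- The functional `ℓ` normalizes the scalar part: `ℓ (K t - f t) = 0` passes to the limit `g 0`,
  -- which is therefore not scalar unless it is zero.
  obtain ⟨ℓ, hℓ⟩ := SeparatingDual.exists_eq_one (R := ℂ) (one_ne_zero : (1 : E →L[ℂ] E) ≠ 0)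
  have hf : AnalyticAt ℂ (fun t => ℓ (K t)) 0 := (ℓ.analyticAt _).comp hK
  have hK0 : AnalyticAt ℂ (fun t => K t - ℓ (K t) • (1 : E →L[ℂ] E)) 0 :=
    hK.sub (hf.smul analyticAt_const)
  refine ⟨fun t => ℓ (K t), hf, ?_⟩
  by_cases h : ∀ᶠ t in 𝓝 0, K t - ℓ (K t) • (1 : E →L[ℂ] E) = 0
  · exact .inl (h.mono fun t ht => sub_eq_zero.1 ht)
  obtain ⟨m, g, hg, hg0, hgK⟩ := hK0.exists_eventuallyEq_pow_smul_nonzero_iff.2 h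
  refine .inr ⟨m, g, hg, fun c hc => hg0 ?_, ?_⟩
  · have h1 : ℓ (g 0) = 0 := by
      have h2 : Tendsto (fun t => ℓ (g t)) (𝓝[≠] 0) (𝓝 (ℓ (g 0))) :=
        ((ℓ.continuous.tendsto _).comp hg.continuousAt.tendsto).mono_left nhdsWithin_le_nhds
      refine tendsto_nhds_unique_of_eventuallyEq h2 tendsto_const_nhds ?_
      filter_upwards [hgK.filter_mono nhdsWithin_le_nhds, self_mem_nhdsWithin] with t ht ht0
      have h3 := congrArg ℓ ht
      have h4 : t ^ m ≠ 0 := pow_ne_zero _ ht0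
      simpa [hℓ, h4] using h3.symm
    rw [hc, map_smul, hℓ, smul_eq_mul, mul_one] at h1
    rw [hc, h1, zero_smul]
  · filter_upwards [hgK] with t ht
    rw [sub_zero] at ht
    rw [← ht]
    abel

/-- **Rellich's theorem** in finite dimension. -/
theorem hasAnalyticDiagonalization [FiniteDimensional ℂ E] : HasAnalyticDiagonalization E H := by
  induction hn : Module.finrank ℂ E using Nat.strong_induction_on generalizing E with
  | _ n ih =>
  intro K W hK hW hWi hsym
  rcases subsingleton_or_nontrivial E with hE | hE
  · rw [Module.finrank_zero_of_subsingleton]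
    exact ⟨Fin.elim0, Fin.elim0, nofun, nofun, linearIndependent_empty_type, nofun, nofun⟩
  obtain ⟨f, hf, h | ⟨m, g, hg, hg0, hgK⟩⟩ := exists_scalar_add_pow_smul hK
  · refine ⟨fun _ => f, fun i _ => Module.finBasis ℂ E i, fun _ => hf, fun _ => analyticAt_const,
      (Module.finBasis ℂ E).linearIndependent, fun _ => Submodule.mem_top, fun i => ?_⟩
    filter_upwards [h] with t ht
    rw [ht]
    simp
  -- For an eigenvalue `c` of `g 0`, the kernel and the range of `D = g 0 - c` are proper subspaces,
  -- and `K t = f t + t ^ m (D + b t + c)` with `b 0 = 0`.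
  obtain ⟨c, hc⟩ := Module.End.exists_eigenvalue ((g 0 : E →L[ℂ] E) : E →ₗ[ℂ] E)
  set D : E →L[ℂ] E := g 0 - c • (1 : E →L[ℂ] E) with hD
  set b : ℂ → E →L[ℂ] E := fun t => g t - g 0 with hb
  have hba : AnalyticAt ℂ b 0 := hg.sub analyticAt_const
  have hb0 : b 0 = 0 := sub_self _
  have hsymg : ∀ᶠ t : ℝ in 𝓝[≠] 0, IsSymmUpToScalar (W t) (g t) := by
    filter_upwards [hsym, tendsto_ofReal_punctured.eventually hgK, self_mem_nhdsWithin]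
      with t h1 h2 h3
    have h4 := h1.sub_smul_one (f t)
    rw [h2, add_sub_cancel_left, ← Complex.ofReal_pow] at h4
    exact h4.of_ofReal_smul (pow_ne_zero _ h3)
  have hsymD : IsSymmUpToScalar (W 0) D :=
    (IsSymmUpToScalar.of_tendsto (hW.tendsto.comp tendsto_ofReal_punctured)
      (hg.continuousAt.tendsto.comp tendsto_ofReal_punctured) hsymg).sub_smul_one c
  have hsymDb : ∀ᶠ t : ℝ in 𝓝[≠] 0, IsSymmUpToScalar (W t) (D + b t) := by
    filter_upwards [hsymg] with t ht
    have : D + b t = g t - c • (1 : E →L[ℂ] E) := by simp only [hD, hb]; abel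
    rw [this]
    exact ht.sub_smul_one c
  have hdisj := hsymD.disjoint_ker_range hWi
  obtain ⟨s, p, hpp, hDp, hpD, hDs, hsD, hps, hsp, hpfix⟩ := exists_reducedResolvent hdisj
  set N₁ := LinearMap.ker (D : E →ₗ[ℂ] E) with hN₁
  set N₂ := LinearMap.range (D : E →ₗ[ℂ] E) with hN₂
  have hrank : Module.finrank ℂ N₂ + Module.finrank ℂ N₁ = Module.finrank ℂ E :=
    LinearMap.finrank_range_add_finrank_ker _
  have hN₁pos : 0 < Module.finrank ℂ N₁ := by
    obtain ⟨v, hv⟩ := hc.exists_hasEigenvector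
    have : Nontrivial N₁ := by
      refine ⟨⟨⟨v, ?_⟩, 0, fun h => hv.2 (congrArg Subtype.val h)⟩⟩
      have := hv.apply_eq_smul
      simp only [ContinuousLinearMap.coe_coe] at this
      simp [hN₁, hD, this]
    exact Module.finrank_pos
  have hN₂pos : 0 < Module.finrank ℂ N₂ := by
    by_contra h
    rw [not_lt, Nat.le_zero, Submodule.finrank_eq_zero, LinearMap.range_eq_bot] at h
    refine hg0 c (sub_eq_zero.1 ?_)
    ext x
    exact DFunLike.congr_fun h x
  obtain ⟨x, hx, hx0, hxeq⟩ := exists_analyticAt_riccati s p hba hb0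
  obtain ⟨y, hy, hy0, hyeq⟩ := exists_analyticAt_dualRiccati s p hba hb0
  have h1 : HasAnalyticEigenvectors (fun t => D + b t) N₁ (Module.finrank ℂ N₁) :=
    hasAnalyticEigenvectors_of_graph (ih _ (by omega) rfl) hW hWi hsymDb
      (j := fun t => 1 + x t) (B := fun t => b t * (1 + x t)) (π := p)
      (analyticAt_const.add hx) (by simp [hx0]) (hba.mul (analyticAt_const.add hx))
      (fun v => DFunLike.congr_fun hDp v) hpfix
      (by filter_upwards [hxeq] with t ht using mul_graph_eq hDp hDs hps ht)
  have h2 : HasAnalyticEigenvectors (fun t => D + b t) N₂ (Module.finrank ℂ N₂) :=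
    hasAnalyticEigenvectors_of_graph (ih _ (by omega) rfl) hW hWi hsymDb
      (j := fun t => 1 + y t) (B := fun t => D + b t * (1 + y t)) (π := 1 - p)
      (analyticAt_const.add hy) (by simp [hy0])
      (analyticAt_const.add (hba.mul (analyticAt_const.add hy)))
      (fun v => ⟨s v, DFunLike.congr_fun hDs v⟩)
      (by
        rintro _ ⟨v, rfl⟩
        have h3 : p (D v) = 0 := DFunLike.congr_fun hpD v
        simp [h3])
      (by filter_upwards [hyeq] with t ht using mul_dualGraph_eq hDp hpD hsD hsp hpp ht)
  have h3 := h1.add h2 hdisj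
  rw [add_comm, hrank] at h3
  refine h3.scalar_add_pow_smul hf c m ?_
  filter_upwards [hgK] with t ht
  rw [ht]
  simp only [hD, hb]
  congr 2
  abel

end FiniteDimensional

/-! ### Reduction of a closed eigenvalue problem to the kernel -/

namespace UnboundedOp

section Reduction

variable {E : Type*} [NormedAddCommGroup E] [InnerProductSpace ℂ E]

/-- `P` is a projection onto a space annihilated by `T`, and `S` inverts `T` on the kernel of `P`,
which contains the range of `T`, and vanishes on the range of `P`. -/
structure IsReducedInverse (T : E →ₗ.[ℂ] E) (P S : E →L[ℂ] E) : Prop where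
  idem : ∀ x, P (P x) = P x
  apply_proj : ∀ x, ∃ h : P x ∈ T.domain, T ⟨P x, h⟩ = 0
  apply_inv : ∀ y, ∃ h : S y ∈ T.domain, T ⟨S y, h⟩ = y - P y
  inv_apply : ∀ x : T.domain, S (T x) = x - P x
  proj_apply : ∀ x : T.domain, P (T x) = 0
  proj_inv : ∀ x, P (S x) = 0
  inv_proj : ∀ x, S (P x) = 0

namespace IsReducedInverse

variable {T : E →ₗ.[ℂ] E} {P S V X : E →L[ℂ] E} {χ z : ℂ}

theorem proj_graph (h : IsReducedInverse T P S)
    (hX : X = S * (X * P * (χ • V) * (1 + X) - χ • V * (1 + X))) (x : E) : P (X x) = 0 := by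
  rw [hX]
  exact h.proj_inv _

/-- The graph of a solution `X` of the Riccati equation is invariant under `T + χ V`. -/
theorem apply_graph (h : IsReducedInverse T P S)
    (hX : X = S * (X * P * (χ • V) * (1 + X) - χ • V * (1 + X))) (x : E) :
    ∃ hx : P x + X (P x) ∈ T.domain,
      T ⟨P x + X (P x), hx⟩ + χ • V (P x + X (P x)) =
        P (χ • V (P x + X (P x))) + X (P (χ • V (P x + X (P x)))) := by
  obtain ⟨h1, h2⟩ := h.apply_proj x
  have hXx : X (P x) = S (X (P (χ • V (P x + X (P x)))) - χ • V (P x + X (P x))) := by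
    have := DFunLike.congr_fun hX (P x)
    simpa using this
  obtain ⟨h3, h4⟩ := h.apply_inv (X (P (χ • V (P x + X (P x)))) - χ • V (P x + X (P x)))
  have h5 : X (P x) ∈ T.domain := hXx ▸ h3
  have h6 : T ⟨X (P x), h5⟩ =
      X (P (χ • V (P x + X (P x)))) - χ • V (P x + X (P x)) + P (χ • V (P x + X (P x))) := by
    have h7 : (⟨X (P x), h5⟩ : T.domain) = ⟨_, h3⟩ := Subtype.ext hXx
    rw [h7, h4, map_sub P, h.proj_graph hX]
    abel
  refine ⟨T.domain.add_mem h1 h5, ?_⟩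
  have h8 : T ⟨P x + X (P x), T.domain.add_mem h1 h5⟩ = T ⟨P x, h1⟩ + T ⟨X (P x), h5⟩ :=
    T.map_add ⟨P x, h1⟩ ⟨X (P x), h5⟩
  rw [h8, h2, h6]
  abel

/-- If `z` and `χ` are so small that the Neumann series converges, all eigenvectors for `z` lie on
the graph of `X`, and their projections solve the eigenvalue problem on the range of `P`. -/
theorem eq_graph_of_apply_eq_smul (h : IsReducedInverse T P S)
    (hX : X = S * (X * P * (χ • V) * (1 + X) - χ • V * (1 + X)))
    (hu : IsUnit (1 - (z • S - S * (1 - P - X * P) * (χ • V))))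
    (ψ : T.domain) (hψ : T ψ + χ • V ψ = z • (ψ : E)) :
    (ψ : E) = P ψ + X (P ψ) ∧ P (χ • V (P ψ + X (P ψ))) = z • P ψ := by
  obtain ⟨h1, h2⟩ := h.apply_graph hX (ψ : E)
  set u := P (ψ : E) with hu'
  set m := P (χ • V (u + X u)) with hm
  set w : T.domain := ψ - ⟨u + X u, h1⟩ with hw
  have hPw : P (w : E) = 0 := by
    simp [hw, hu', h.idem, h.proj_graph hX]
  have hPm : P m = m := h.idem _
  have hPu : P u = u := h.idem _
  have hTw : T w + χ • V w = z • (w : E) - ((m - z • u) + X (m - z • u)) := by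
    have h3 : T w + χ • V w = z • (ψ : E) - (m + X m) := by
      rw [← hψ, ← h2, hw, LinearPMap.map_sub]
      simp only [Submodule.coe_sub, map_sub]
      module
    rw [h3, hw]
    simp only [Submodule.coe_sub, map_sub, map_smul]
    module
  have hw0 : (w : E) = 0 := by
    have h4 : (1 - (z • S - S * (1 - P - X * P) * (χ • V)) : E →L[ℂ] E) (w : E) = 0 := by
      have h5 : S (T w) = w := by rw [h.inv_apply, hPw, sub_zero]
      have h6 : T w = z • (w : E) - ((m - z • u) + X (m - z • u)) - χ • V w :=
        eq_sub_of_add_eq hTw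
      have h7 : P (χ • V (w : E)) = - (m - z • u) := by
        have h8 := congrArg P h6
        rw [h.proj_apply] at h8
        simp only [map_sub, map_add, map_smul, h.proj_graph hX, hPm, hPu, hPw] at h8 ⊢
        rw [eq_comm, ← sub_eq_zero] at h8
        rw [← sub_eq_zero, ← neg_eq_zero, ← h8]
        module
      have h9 : S m = 0 := h.inv_proj _
      have h10 : S u = 0 := h.inv_proj _
      have h11 := congrArg S h6
      rw [h5] at h11
      simp only [_root_.sub_apply, _root_.smul_apply, one_apply_eq_self,
        mul_apply_eq_comp]
      rw [h7]
      simp only [map_sub, map_add, map_smul, map_neg, h9, h10] at h11 ⊢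
      rw [← sub_eq_zero] at h11
      refine Eq.trans ?_ h11
      module
    obtain ⟨a, ha⟩ := hu
    have h13 := congrArg (↑a⁻¹ : E →L[ℂ] E) h4
    rw [← ha, map_zero, ← mul_apply_eq_comp, Units.inv_mul] at h13
    exact h13
  have h14 : (ψ : E) = u + X u := by
    have : (ψ : E) - (u + X u) = 0 := hw0
    exact sub_eq_zero.1 this
  refine ⟨h14, ?_⟩
  have h16 : (m - z • u) + X (m - z • u) = 0 := by
    have h15 : w = 0 := Subtype.ext hw0
    rw [hw0, h15, LinearPMap.map_zero, map_zero, smul_zero, smul_zero, zero_sub, add_zero] at hTw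
    exact neg_eq_zero.1 hTw.symm
  have h20 := congrArg P h16
  rw [map_add, h.proj_graph hX, add_zero, map_zero, map_sub, map_smul, hPm, hPu] at h20
  exact sub_eq_zero.1 h20

/-- If `z` and `χ` are so small that the Neumann series converges, a resolvent `J` of the reduced
problem on the range of `P` yields a bounded right inverse of `T + χ V - z`. -/
theorem exists_rightInverse (h : IsReducedInverse T P S)
    (hX : X = S * (X * P * (χ • V) * (1 + X) - χ • V * (1 + X)))
    (hu : IsUnit (1 - (z • S - S * (1 - P - X * P) * (χ • V))))
    {J : E →L[ℂ] E} (hPJ : ∀ y, P (J y) = J y)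
    (hJ : ∀ y, P (χ • V (J y + X (J y))) - z • J y = P y) :
    ∃ R : E →L[ℂ] E, ∀ y, ∃ hy : R y ∈ T.domain,
      T ⟨R y, hy⟩ + χ • V (R y) - z • R y = y := by
  obtain ⟨a, ha⟩ := hu
  -- The solution is `R y = (1 + X) J v + w`, with `w = G y` the component off the graph and
  -- `v = y - χ V w`.
  set G : E →L[ℂ] E := ↑a⁻¹ * S * (1 - P - X * P) with hG
  refine ⟨(1 + X) * J * (1 - χ • V * G) + G, fun y => ?_⟩
  set w := G y with hw
  set v := y - χ • V w with hv
  have hRy : ((1 + X) * J * (1 - χ • V * G) + G) y = (J v + X (J v)) + w := by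
    simp [hv, hw]
  have hw1 : w = S (z • w - (χ • V w - P (χ • V w) - X (P (χ • V w))) + (y - P y - X (P y))) := by
    have h1 : (a : E →L[ℂ] E) w = S (y - P y - X (P y)) := by
      rw [hw, hG, ← mul_apply_eq_comp, ← mul_assoc, ← mul_assoc,
        Units.mul_inv, one_mul]
      simp
    rw [ha] at h1
    simp only [_root_.sub_apply, _root_.smul_apply, one_apply_eq_self,
      mul_apply_eq_comp] at h1
    rw [map_add, ← h1, map_sub S (z • w), map_smul]
    abel
  obtain ⟨h2, h3⟩ := h.apply_inv
    (z • w - (χ • V w - P (χ • V w) - X (P (χ • V w))) + (y - P y - X (P y)))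
  have hPw : P w = 0 := by rw [hw1]; exact h.proj_inv _
  have hw2 : w ∈ T.domain := by rw [hw1]; exact h2
  have h4 : T ⟨w, hw2⟩ =
      z • w - (χ • V w - P (χ • V w) - X (P (χ • V w))) + (y - P y - X (P y)) := by
    have h5 : (⟨w, hw2⟩ : T.domain) = ⟨_, h2⟩ := Subtype.ext hw1
    rw [h5, h3]
    simp only [map_add, map_sub, map_smul, h.proj_graph hX, h.idem, hPw]
    module
  obtain ⟨h6, h7⟩ := h.apply_graph hX (J v)
  simp only [hPJ] at h6 h7
  have h8 : J v + X (J v) + w ∈ T.domain := T.domain.add_mem h6 hw2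
  refine ⟨hRy ▸ h8, ?_⟩
  have h9 : (⟨((1 + X) * J * (1 - χ • V * G) + G) y, hRy ▸ h8⟩ : T.domain) =
      ⟨J v + X (J v), h6⟩ + ⟨w, hw2⟩ := Subtype.ext hRy
  rw [← eq_sub_iff_add_eq] at h7
  rw [h9, LinearPMap.map_add, h7, hRy, h4]
  have h10 : P (χ • V (J v + X (J v))) = z • J v + P v := by rw [← hJ v]; abel
  rw [h10, hv]
  simp only [map_add, map_sub, map_smul]
  module

end IsReducedInverse

theorem mem_resolventSet_of_rightInverse {T : E →ₗ.[ℂ] E} {z : ℂ} {R : E →L[ℂ] E}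
    (hR : ∀ y, ∃ hy : R y ∈ T.domain, T ⟨R y, hy⟩ - z • R y = y)
    (hker : ∀ x : T.domain, T x = z • (x : E) → (x : E) = 0) : z ∈ resolventSet T := by
  refine ⟨R, hR, fun x => ?_⟩
  obtain ⟨hy, h⟩ := hR (T x - z • (x : E))
  have h1 := hker (⟨_, hy⟩ - x) (by
    rw [LinearPMap.map_sub, Submodule.coe_sub, smul_sub]
    rw [sub_eq_iff_eq_add] at h
    rw [h]
    abel)
  exact sub_eq_zero.1 h1

theorem HasEigenvalue.mem_spectrum {T : E →ₗ.[ℂ] E} {z : ℂ} (h : HasEigenvalue T z) :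
    z ∈ spectrum T := by
  rintro ⟨R, -, hR⟩
  obtain ⟨x, hx, hTx⟩ := h
  have h1 := hR x
  rw [hTx, sub_self, map_zero] at h1
  exact hx h1.symm

end Reduction

end UnboundedOp

theorem Module.Basis.mem_span_of_apply_eq_smul {ι K M : Type*} [Field K] [AddCommGroup M]
    [Module K M] (B : Module.Basis ι K M) {f : M →ₗ[K] M} {lam : ι → K}
    (hf : ∀ i, f (B i) = lam i • B i) {z : K} {u : M} (hu : f u = z • u) :
    u ∈ Submodule.span K (B '' {i | lam i = z}) := by
  have h1 : ∀ i, B.repr (f u) i = lam i * B.repr u i := by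
    intro i
    have : (Finsupp.lapply i ∘ₗ (B.repr : M →ₗ[K] ι →₀ K)) ∘ₗ f =
        lam i • (Finsupp.lapply i ∘ₗ (B.repr : M →ₗ[K] ι →₀ K)) := by
      refine B.ext fun j => ?_
      by_cases h : j = i
      · subst h; simp [hf]
      · simp [hf, h]
    exact LinearMap.congr_fun this u
  rw [B.mem_span_image]
  intro i hi
  have h2 := h1 i
  rw [hu, map_smul, Finsupp.smul_apply, smul_eq_mul] at h2
  exact (mul_right_cancel₀ (Finsupp.mem_support_iff.1 hi) h2).symm

/-! ### Eigenvalues and eigenvectors near zero of a bounded perturbation -/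

namespace UnboundedOp

variable {E : Type*} [NormedAddCommGroup E] [InnerProductSpace ℂ E]

namespace IsReducedInverse

variable {T : E →ₗ.[ℂ] E} {P S V X : E →L[ℂ] E} {χ z : ℂ} {N : Submodule ℂ E}

section FixedCoupling

variable {ι : Type*} {lam : ι → ℂ}

theorem perturb_graph_eigenvector (h : IsReducedInverse T P S) (hPN : ∀ x ∈ N, P x = x)
    (hX : X = S * (X * P * (χ • V) * (1 + X) - χ • V * (1 + X))) {e : N} {l : ℂ}
    (he : P (χ • V (e + X e)) = l • (e : E)) :
    ∃ hx : (e : E) + X e ∈ (perturb T V χ).domain,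
      perturb T V χ ⟨e + X e, hx⟩ = l • ((e : E) + X e) := by
  obtain ⟨h1, h2⟩ := h.apply_graph hX (e : E)
  simp only [hPN e e.2] at h1 h2
  refine ⟨h1, h2.trans ?_⟩
  rw [he, map_smul, smul_add]

theorem perturb_eq_smul_iff (h : IsReducedInverse T P S) (hP : ∀ x, P x ∈ N)
    (hPN : ∀ x ∈ N, P x = x)
    (hX : X = S * (X * P * (χ • V) * (1 + X) - χ • V * (1 + X)))
    (hu : IsUnit (1 - (z • S - S * (1 - P - X * P) * (χ • V)))) (B : Module.Basis ι ℂ N)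
    (hB : ∀ i, P (χ • V (B i + X (B i))) = lam i • (B i : E)) (ψ : (perturb T V χ).domain) :
    perturb T V χ ψ = z • (ψ : E) ↔
      (ψ : E) ∈ Submodule.span ℂ ((fun i => (B i : E) + X (B i)) '' {i | lam i = z}) := by
  constructor
  · intro hψ
    obtain ⟨h1, h2⟩ := h.eq_graph_of_apply_eq_smul hX hu ψ hψ
    set f : N →L[ℂ] N := P.codRestrict N hP ∘L (χ • V * (1 + X)) ∘L N.subtypeL with hf
    have h3 := B.mem_span_of_apply_eq_smul (f := (f : N →ₗ[ℂ] N)) (lam := lam) (z := z)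
      (u := ⟨P ψ, hP ψ⟩) (fun i => Subtype.ext (by simpa [hf] using hB i))
      (Subtype.ext (by simpa [hf] using h2))
    have h4 := Submodule.mem_map_of_mem (f := ((1 + X : E →L[ℂ] E) : E →ₗ[ℂ] E) ∘ₗ N.subtype) h3
    rw [Submodule.map_span, ← Set.image_comp] at h4
    rw [h1]
    exact h4
  · intro hψ
    have h1 : ∀ v ∈ Submodule.span ℂ ((fun i => (B i : E) + X (B i)) '' {i | lam i = z}),
        ∃ hv : v ∈ (perturb T V χ).domain, perturb T V χ ⟨v, hv⟩ = z • v := by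
      intro v hv
      induction hv using Submodule.span_induction with
      | mem v hv =>
        obtain ⟨i, hi, rfl⟩ := hv
        obtain ⟨h2, h3⟩ := h.perturb_graph_eigenvector hPN hX (hB i)
        exact ⟨h2, by rw [h3, hi]⟩
      | zero => exact ⟨Submodule.zero_mem _, by rw [smul_zero]; exact LinearPMap.map_zero _⟩
      | add v w _ _ hv hw =>
        obtain ⟨h2, h3⟩ := hv
        obtain ⟨h4, h5⟩ := hw
        refine ⟨Submodule.add_mem _ h2 h4, ?_⟩
        rw [smul_add, ← h3, ← h5]
        exact LinearPMap.map_add _ ⟨v, h2⟩ ⟨w, h4⟩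
      | smul c v _ hv =>
        obtain ⟨h2, h3⟩ := hv
        refine ⟨Submodule.smul_mem _ c h2, ?_⟩
        rw [smul_comm, ← h3]
        exact LinearPMap.map_smul _ c ⟨v, h2⟩
    exact (h1 ψ hψ).2

theorem mem_resolventSet_perturb [FiniteDimensional ℂ N] (h : IsReducedInverse T P S)
    (hP : ∀ x, P x ∈ N) (hPN : ∀ x ∈ N, P x = x)
    (hX : X = S * (X * P * (χ • V) * (1 + X) - χ • V * (1 + X)))
    (hu : IsUnit (1 - (z • S - S * (1 - P - X * P) * (χ • V)))) (B : Module.Basis ι ℂ N)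
    (hB : ∀ i, P (χ • V (B i + X (B i))) = lam i • (B i : E)) (hz : ∀ i, lam i ≠ z) :
    z ∈ resolventSet (perturb T V χ) := by
  have hempty : {i | lam i = z} = ∅ := Set.eq_empty_of_forall_notMem hz
  set f : N →L[ℂ] N := P.codRestrict N hP ∘L (χ • V * (1 + X)) ∘L N.subtypeL with hf
  have hinj : Function.Injective (f - z • (1 : N →L[ℂ] N)) := by
    rw [injective_iff_map_eq_zero]
    intro u hu
    have h1 := B.mem_span_of_apply_eq_smul (f := (f : N →ₗ[ℂ] N)) (lam := lam) (z := z)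
      (u := u) (fun i => Subtype.ext (by simpa [hf] using hB i))
      (by simpa [sub_eq_zero] using hu)
    simpa [hempty] using h1
  set F : N ≃L[ℂ] N := (LinearEquiv.ofInjectiveEndo
    ((f - z • (1 : N →L[ℂ] N) : N →L[ℂ] N) : N →ₗ[ℂ] N) hinj).toContinuousLinearEquiv with hF
  have hFf : ∀ u, f (F.symm u) - z • F.symm u = u := fun u => F.apply_symm_apply u
  obtain ⟨R, hR⟩ := h.exists_rightInverse hX hu
    (J := N.subtypeL ∘L (F.symm : N →L[ℂ] N) ∘L P.codRestrict N hP)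
    (fun y => hPN _ (Subtype.mem _))
    (fun y => by simpa [hf] using congrArg Subtype.val (hFf (P.codRestrict N hP y)))
  refine mem_resolventSet_of_rightInverse hR fun x hx => ?_
  simpa [hempty] using (h.perturb_eq_smul_iff hP hPN hX hu B hB x).1 hx

end FixedCoupling

/-- Perturbation theory of the isolated eigenvalue `0` of a symmetric operator `T`, of finite
multiplicity, under `χ V` with `V` bounded and symmetric. -/
theorem exists_analytic_eigenvectors [CompleteSpace E] [FiniteDimensional ℂ N]
    (h : IsReducedInverse T P S) (hP : ∀ x, P x ∈ N) (hPN : ∀ x ∈ N, P x = x)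
    (hT : ∀ x y : T.domain, ⟪(x : E), T y⟫_ℂ = ⟪T x, (y : E)⟫_ℂ)
    (hV : ∀ x y, ⟪x, V y⟫_ℂ = ⟪V x, y⟫_ℂ) :
    ∃ (R δ : ℝ) (lam : Fin (Module.finrank ℂ N) → ℂ → ℂ)
      (φ : Fin (Module.finrank ℂ N) → ℂ → E), 0 < R ∧ 0 < δ ∧ (∀ s, lam s 0 = 0) ∧
      (∀ s, AnalyticOnNhd ℂ (lam s) (Metric.ball 0 R)) ∧
      (∀ s, AnalyticOnNhd ℂ (φ s) (Metric.ball 0 R)) ∧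
      ∀ χ ∈ Metric.ball (0 : ℂ) R,
        LinearIndependent ℂ (fun s => φ s χ) ∧
        (∀ s, ∃ h : φ s χ ∈ (perturb T V χ).domain,
          perturb T V χ ⟨φ s χ, h⟩ = lam s χ • φ s χ) ∧
        spectrum (perturb T V χ) ∩ Metric.ball 0 δ = Set.range (fun s => lam s χ) ∧
        ∀ z ∈ Metric.ball (0 : ℂ) δ, ∀ ψ : (perturb T V χ).domain,
          perturb T V χ ψ = z • (ψ : E) ↔
            (ψ : E) ∈ Submodule.span ℂ ((fun s => φ s χ) '' {s | lam s χ = z}) := by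
  have hb : AnalyticAt ℂ (fun χ : ℂ => χ • V) 0 := analyticAt_id.smul analyticAt_const
  obtain ⟨X, hX, hX0, hXeq⟩ := exists_analyticAt_riccati S P hb (zero_smul _ _)
  have hX1 : AnalyticAt ℂ (fun χ => 1 + X χ) 0 := analyticAt_const.add hX
  set K : ℂ → N →L[ℂ] N := fun χ =>
    P.codRestrict N hP ∘L (χ • V * (1 + X χ)) ∘L N.subtypeL with hKdef
  have hK : AnalyticAt ℂ K 0 := (hb.mul hX1).conj_clm _ _
  have hKapply : ∀ χ (u : N), (K χ u : E) = P (χ • V (u + X χ u)) := fun χ u => by simp [hKdef]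
  have hsym : ∀ᶠ t : ℝ in 𝓝[≠] 0, IsSymmUpToScalar ((1 + X t) ∘L N.subtypeL) (K t) := by
    filter_upwards [tendsto_ofReal_punctured.eventually hXeq] with t ht
    refine .of_symm fun u v => ?_
    obtain ⟨h1, h2⟩ := h.apply_graph ht (u : E)
    obtain ⟨h3, h4⟩ := h.apply_graph ht (v : E)
    simp only [hPN u u.2, hPN v v.2, ← hKapply] at h1 h2 h3 h4
    change ⟪(u : E) + X t u, (K t v : E) + X t (K t v)⟫_ℂ =
      ⟪(K t u : E) + X t (K t u), (v : E) + X t v⟫_ℂ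
    rw [← h2, ← h4, inner_add_right, inner_add_left (T ⟨_, h1⟩), ← hT ⟨_, h1⟩ ⟨_, h3⟩,
      inner_smul_right, inner_smul_left, hV, Complex.conj_ofReal]
  obtain ⟨lam, e, hlam, he, hind, -, heig⟩ := hasAnalyticDiagonalization (E := N) (H := E) K
    (fun χ => (1 + X χ) ∘L N.subtypeL) hK (hX1.continuousAt.clm_comp continuousAt_const)
    (by simp [hX0, Function.Injective]) hsym
  -- This makes `‖z • S‖ ≤ 1 / 2` for `|z| < δ`, independently of `χ`.
  set δ : ℝ := (2 * (‖S‖ + 1))⁻¹ with hδ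
  have hδ0 : 0 < δ := by positivity
  have hlam0 : ∀ s, lam s 0 = 0 := by
    intro s
    have h1 := (heig s).self_of_nhds
    have h2 : K 0 = 0 := by ext; simp [hKdef]
    rw [h2, _root_.zero_apply] at h1
    exact (smul_eq_zero.1 h1.symm).resolve_right (hind.ne_zero s)
  have hind' : ∀ᶠ χ in 𝓝 0, LinearIndependent ℂ (fun s => e s χ) := by
    have h1 : ContinuousAt (fun χ s => e s χ) 0 := continuousAt_pi.2 fun s => (he s).continuousAt
    exact h1.eventually (isOpen_setOfPred_linearIndependent.mem_nhds hind)
  have hsmall : ∀ᶠ χ in 𝓝 0, ‖S * (1 - P - X χ * P) * (χ • V)‖ < 1 / 2 := by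
    have h1 : AnalyticAt ℂ (fun χ => S * (1 - P - X χ * P) * (χ • V)) 0 :=
      (analyticAt_const.mul (analyticAt_const.sub (hX.mul analyticAt_const))).mul hb
    refine h1.continuousAt.norm.eventually_lt continuousAt_const ?_
    simp
  have hlamδ : ∀ᶠ χ in 𝓝 0, ∀ s, lam s χ ∈ Metric.ball 0 δ :=
    eventually_all.2 fun s => (hlam s).continuousAt.eventually
      (by rw [hlam0]; exact Metric.ball_mem_nhds _ hδ0)
  have hall := ((eventually_all.2 fun s => (hlam s).eventually_analyticAt).and
    (eventually_all.2 fun s => (he s).eventually_analyticAt)).and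
    ((hX.eventually_analyticAt.and hXeq).and
    ((hind'.and (eventually_all.2 heig)).and (hsmall.and hlamδ)))
  obtain ⟨R, hR, hball⟩ := Metric.eventually_nhds_iff_ball.1 hall
  refine ⟨R, δ, lam, fun s χ => e s χ + X χ (e s χ), hR, hδ0, hlam0,
    fun s χ hχ => (hball χ hχ).1.1 s, fun s χ hχ => ?_, fun χ hχ => ?_⟩
  · obtain ⟨⟨-, h1⟩, ⟨h2, -⟩, -⟩ := hball χ hχ
    have h3 : AnalyticAt ℂ (fun χ => (e s χ : E)) χ := (N.subtypeL.analyticAt _).comp (h1 s)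
    exact h3.add (h2.clm_apply_of_clm h3)
  obtain ⟨-, ⟨-, hXχ⟩, ⟨hindχ, heigχ⟩, hsmallχ, hlamχ⟩ := hball χ hχ
  have heigχ' : ∀ s, P (χ • V (e s χ + X χ (e s χ))) = lam s χ • (e s χ : E) := fun s => by
    rw [← hKapply, heigχ s, Submodule.coe_smul]
  set B : Module.Basis (Fin (Module.finrank ℂ N)) ℂ N :=
    basisOfLinearIndependentOfCardEqFinrank' _ hindχ (Fintype.card_fin _) with hB
  have hBe : ∀ s, B s = e s χ := fun s => by simp [hB]
  have hBeig : ∀ s, P (χ • V (B s + X χ (B s))) = lam s χ • (B s : E) := fun s => by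
    rw [hBe]; exact heigχ' s
  have hunit : ∀ z ∈ Metric.ball (0 : ℂ) δ,
      IsUnit (1 - (z • S - S * (1 - P - X χ * P) * (χ • V))) := by
    intro z hz
    apply isUnit_one_sub_of_norm_lt_one
    have h1 : ‖z • S‖ ≤ 1 / 2 := by
      rw [norm_smul]
      have h2 : ‖z‖ ≤ δ := by simpa using (mem_ball_zero_iff.1 hz).le
      calc ‖z‖ * ‖S‖ ≤ δ * (‖S‖ + 1) := by gcongr; linarith
        _ = 1 / 2 := by rw [hδ]; field_simp
    linarith [norm_sub_le (z • S) (S * (1 - P - X χ * P) * (χ • V))]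
  have heigen := fun s => h.perturb_graph_eigenvector (T := T) hPN hXχ (heigχ' s)
  have hindφ : LinearIndependent ℂ (fun s => (e s χ : E) + X χ (e s χ)) := by
    refine LinearIndependent.of_comp (P : E →ₗ[ℂ] E) ?_
    have h1 : (P : E →ₗ[ℂ] E) ∘ (fun s => (e s χ : E) + X χ (e s χ)) =
        N.subtype ∘ fun s => e s χ := by
      funext s
      simp [hPN _ (e s χ).2, h.proj_graph hXχ]
    rw [h1]
    exact hindχ.map' _ N.ker_subtype
  refine ⟨hindφ, heigen, ?_, fun z hz ψ => ?_⟩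
  · ext z
    constructor
    · rintro ⟨hz, hzδ⟩
      by_contra hne
      exact hz (h.mem_resolventSet_perturb hP hPN hXχ (hunit z hzδ) B hBeig
        fun s hs => hne ⟨s, hs⟩)
    · rintro ⟨s, rfl⟩
      obtain ⟨h1, h2⟩ := heigen s
      exact ⟨HasEigenvalue.mem_spectrum ⟨⟨_, h1⟩, hindφ.ne_zero s, h2⟩, hlamχ s⟩
  · have := h.perturb_eq_smul_iff hP hPN hXχ (hunit z hz) B hBeig ψ
    simpa only [hBe] using this

end IsReducedInverse

end UnboundedOp

/-! ### The Friedrichs extension and the reduced inverse -/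

namespace UnboundedOp

variable {E : Type*} [NormedAddCommGroup E] [InnerProductSpace ℂ E]

section Friedrichs

variable {A : E →ₗ.[ℂ] E}

/-- Cauchy–Schwarz inequality for the form `⟪x, A y⟫`. -/
theorem norm_inner_sq_le (hA : A.IsFormalAdjoint A) (h : ∀ x, 0 ≤ quadForm A x)
    (x y : A.domain) : ‖⟪(x : E), A y⟫_ℂ‖ ^ 2 ≤ quadForm A x * quadForm A y := by
  let core : PreInnerProductSpace.Core ℂ A.domain :=
    { inner := fun x y => ⟪(x : E), A y⟫_ℂ
      conj_inner_symm := fun x y => by rw [inner_conj_symm]; exact hA x y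
      re_inner_nonneg := h
      add_left := fun x y z => inner_add_left _ _ _
      smul_left := fun x y r => inner_smul_left _ _ _ }
  -- The type of `A.domain` carries the inner product of `E`, so the form is passed explicitly.
  have h1 := @InnerProductSpace.Core.inner_mul_inner_self_le ℂ A.domain _ _ _ core x y
  change ‖⟪(x : E), A y⟫_ℂ‖ * ‖⟪(y : E), A x⟫_ℂ‖ ≤ quadForm A x * quadForm A y at h1
  rwa [norm_inner_symm (y : E), hA x y, ← sq] at h1

theorem exists_bound_of_cauchy (h : ∀ x, 0 ≤ quadForm A x) {v : ℕ → A.domain}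
    (hv : Tendsto (fun p : ℕ × ℕ => quadForm A (v p.1 - v p.2)) atTop (𝓝 0)) :
    ∃ M > 0, ∀ᶠ n in atTop, quadForm A (v n) ≤ M := by
  obtain ⟨⟨a, b⟩, hab⟩ := eventually_atTop.1 (hv.eventually_lt_const one_pos)
  refine ⟨2 * 1 + 2 * quadForm A (v b), by linarith [h (v b)], ?_⟩
  filter_upwards [eventually_ge_atTop a] with n hn
  have h1 := quadForm_add_le A h (v n - v b) (v b)
  rw [sub_add_cancel] at h1
  linarith [hab (n, b) ⟨hn, le_rfl⟩]

/-- If `x' = A† x`, then `⟪x', y⟫` is the value at `(x, y)` of the closure of the form of `A`. -/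
theorem tendsto_inner_of_form_cauchy (hA : A.IsFormalAdjoint A) (h : ∀ x, 0 ≤ quadForm A x)
    {x x' y : E} (hx : ∀ z : A.domain, ⟪x', (z : E)⟫_ℂ = ⟪x, A z⟫_ℂ) {u v : ℕ → A.domain}
    (hu : Tendsto (fun n => (u n : E)) atTop (𝓝 x))
    (hu' : Tendsto (fun p : ℕ × ℕ => quadForm A (u p.1 - u p.2)) atTop (𝓝 0))
    (hv : Tendsto (fun n => (v n : E)) atTop (𝓝 y))
    (hv' : Tendsto (fun p : ℕ × ℕ => quadForm A (v p.1 - v p.2)) atTop (𝓝 0)) :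
    Tendsto (fun n => ⟪(u n : E), A (v n)⟫_ℂ) atTop (𝓝 ⟪x', y⟫_ℂ) := by
  have h1 : Tendsto (fun n => ⟪x', (v n : E)⟫_ℂ) atTop (𝓝 ⟪x', y⟫_ℂ) :=
    tendsto_const_nhds.inner hv
  suffices h2 : Tendsto (fun n => ⟪x', (v n : E)⟫_ℂ - ⟪(u n : E), A (v n)⟫_ℂ) atTop (𝓝 0) by
    simpa using h1.sub h2
  rw [Metric.tendsto_nhds]
  intro ε hε
  obtain ⟨M, hM, hvM⟩ := exists_bound_of_cauchy h hv'
  obtain ⟨⟨a, b⟩, hab⟩ := eventually_atTop.1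
    (hu'.eventually_lt_const (show 0 < (ε / 2) ^ 2 / M by positivity))
  filter_upwards [hvM, eventually_ge_atTop b] with n hn hbn
  rw [dist_zero_right, hx]
  have h3 : Tendsto (fun m => ‖⟪(u m : E), A (v n)⟫_ℂ - ⟪(u n : E), A (v n)⟫_ℂ‖) atTop
      (𝓝 ‖⟪x, A (v n)⟫_ℂ - ⟪(u n : E), A (v n)⟫_ℂ‖) :=
    ((hu.inner tendsto_const_nhds).sub_const _).norm
  refine lt_of_le_of_lt (le_of_tendsto h3 ?_) (half_lt_self hε)
  filter_upwards [eventually_ge_atTop a] with m hm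
  rw [← inner_sub_left]
  refine abs_le_of_sq_le_sq' ?_ (by positivity) |>.2
  calc _ ≤ quadForm A (u m - u n) * quadForm A (v n) := norm_inner_sq_le hA h (u m - u n) (v n)
    _ ≤ (ε / 2) ^ 2 / M * M :=
      mul_le_mul (hab (m, n) ⟨hm, hbn⟩).le hn (h _) (by positivity)
    _ = (ε / 2) ^ 2 := by field_simp

theorem friedrichs_symm [CompleteSpace E] (hd : Dense (A.domain : Set E))
    (hA : A.IsFormalAdjoint A) (h : ∀ x, 0 ≤ quadForm A x) (x y : (friedrichs A h).domain) :
    ⟪(x : E), friedrichs A h y⟫_ℂ = ⟪friedrichs A h x, (y : E)⟫_ℂ := by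
  have hadj : ∀ (x : (friedrichs A h).domain) (z : A.domain),
      ⟪friedrichs A h x, (z : E)⟫_ℂ = ⟪(x : E), A z⟫_ℂ := fun x z =>
    LinearPMap.adjoint_isFormalAdjoint hd ⟨x, x.2.2⟩ z
  obtain ⟨u, hu, hu'⟩ := x.2.1
  obtain ⟨v, hv, hv'⟩ := y.2.1
  have h1 := tendsto_inner_of_form_cauchy hA h (hadj x) hu hu' hv hv'
  have h2 := tendsto_inner_of_form_cauchy hA h (hadj y) hv hv' hu hu'
  have h3 := (Complex.continuous_conj.tendsto _).comp h2
  rw [inner_conj_symm] at h3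
  refine (tendsto_nhds_unique h1 (h3.congr fun n => ?_)).symm
  simp only [Function.comp_apply, inner_conj_symm]
  exact hA _ _

theorem friedrichs_extends [CompleteSpace E] (hd : Dense (A.domain : Set E))
    (hA : A.IsFormalAdjoint A) (h : ∀ x, 0 ≤ quadForm A x) (x : A.domain) :
    ∃ hx : (x : E) ∈ (friedrichs A h).domain, friedrichs A h ⟨x, hx⟩ = A x := by
  have h1 := hA.le_adjoint hd
  have hx : (x : E) ∈ (friedrichs A h).domain :=
    ⟨⟨fun _ => x, tendsto_const_nhds, by simp [quadForm]⟩, h1.1 x.2⟩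
  exact ⟨hx, (h1.2 (x := x) (y := ⟨x, hx.2⟩) rfl).symm⟩

end Friedrichs

/-- Here `0 ∈ resolventSet (part T Nᗮ)` is the spectral gap. -/
theorem exists_isReducedInverse [CompleteSpace E] {T : E →ₗ.[ℂ] E} {N : Submodule ℂ E}
    [FiniteDimensional ℂ N]
    (hT : ∀ x y : T.domain, ⟪(x : E), T y⟫_ℂ = ⟪T x, (y : E)⟫_ℂ)
    (hN : ∀ x ∈ N, ∃ h : x ∈ T.domain, T ⟨x, h⟩ = 0)
    (h0 : 0 ∈ resolventSet (part T Nᗮ)) : ∃ S, IsReducedInverse T N.starProjection S := by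
  obtain ⟨R, hR1, hR2⟩ := h0
  have hfix : ∀ x ∈ N, N.starProjection x = x := fun x hx =>
    Submodule.starProjection_eq_self_iff.2 hx
  have hzero : ∀ x ∈ Nᗮ, N.starProjection x = 0 := fun x hx => by
    have : x ∈ LinearMap.ker (N.starProjection : E →ₗ[ℂ] E) := by
      rwa [Submodule.ker_starProjection]
    exact this
  set r : E →L[ℂ] Nᗮ := (1 - N.starProjection).codRestrict Nᗮ
    (fun x => N.sub_starProjection_mem_orthogonal x) with hr
  have hrapply : ∀ x, (r x : E) = x - N.starProjection x := fun x => rfl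
  have hrange : ∀ x : T.domain, T x ∈ Nᗮ := by
    intro x
    rw [Submodule.mem_orthogonal]
    intro u hu
    obtain ⟨h1, h2⟩ := hN u hu
    rw [hT ⟨u, h1⟩ x, h2, inner_zero_left]
  refine ⟨Nᗮ.subtypeL ∘L R ∘L r, ?_, ?_, ?_, ?_, ?_, ?_, ?_⟩
  · exact fun x => hfix _ (N.starProjection_apply_mem x)
  · exact fun x => hN _ (N.starProjection_apply_mem x)
  · intro y
    obtain ⟨h1, h2⟩ := hR1 (r y)
    refine ⟨h1.1, ?_⟩
    rw [zero_smul, sub_zero] at h2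
    exact congrArg Subtype.val h2
  · intro x
    obtain ⟨h1, h2⟩ := hN _ (N.starProjection_apply_mem (x : E))
    have h3 : T (x - ⟨_, h1⟩) = T x := by rw [LinearPMap.map_sub, h2, sub_zero]
    have h4 : (⟨x - N.starProjection x, N.sub_starProjection_mem_orthogonal x⟩ : Nᗮ) ∈
        (part T Nᗮ).domain := ⟨(x - ⟨_, h1⟩ : T.domain).2, hrange _⟩
    have h5 := hR2 ⟨_, h4⟩
    rw [zero_smul, sub_zero] at h5
    have h6 : part T Nᗮ ⟨_, h4⟩ = r (T x) := by
      refine Subtype.ext (h3.trans ?_)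
      rw [hrapply, hzero _ (hrange x), sub_zero]
    rw [h6] at h5
    exact congrArg Subtype.val h5
  · exact fun x => hzero _ (hrange x)
  · exact fun x => hzero _ (Subtype.mem _)
  · intro x
    have : r (N.starProjection x) = 0 := by
      refine Subtype.ext ?_
      rw [hrapply, hfix _ (N.starProjection_apply_mem x), sub_self, Submodule.coe_zero]
    simp [this]

end UnboundedOp

/-! ### Continuous selections from analytic functions -/

theorem isPreconnected_ball_diff_zero (r : ℝ) :
    IsPreconnected (Metric.ball (0 : ℂ) r \ {0}) := by
  have h1 : Metric.ball (0 : ℂ) r \ {0} =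
      (fun q : ℝ × ℝ => (q.1 : ℂ) * Complex.exp (q.2 * Complex.I)) ''
        (Set.Ioo 0 r ×ˢ Set.univ) := by
    ext k
    constructor
    · rintro ⟨hk, hk0⟩
      exact ⟨(‖k‖, k.arg), ⟨⟨norm_pos_iff.2 hk0, mem_ball_zero_iff.1 hk⟩, trivial⟩,
        Complex.norm_mul_exp_arg_mul_I k⟩
    · rintro ⟨⟨ρ, θ⟩, ⟨⟨h1, h2⟩, -⟩, rfl⟩
      refine ⟨?_, ?_⟩
      · simpa [Complex.norm_exp_ofReal_mul_I, abs_of_pos h1] using h2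
      · simpa using h1.ne'
  rw [h1]
  exact (isPreconnected_Ioo.prod isPreconnected_univ).image _ (by fun_prop)

/-- A continuous function that takes at each point the value of one of finitely many analytic
functions agreeing at `0` coincides near `0` with one of them. -/
theorem exists_eventuallyEq_of_continuous_selection {ι : Type*} [Finite ι] {f : ι → ℂ → ℂ}
    (hf : ∀ i, AnalyticAt ℂ (f i) 0) (hf0 : ∀ i, f i 0 = 0) {ω : ℂ → ℂ}
    (hω : ∀ᶠ k in 𝓝 0, ContinuousAt ω k) (hω0 : ω 0 = 0) (h : ∀ᶠ k in 𝓝 0, ∃ i, ω k = f i k) :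
    ∃ i, ω =ᶠ[𝓝 0] f i := by
  have hdich : ∀ i j, ∀ᶠ k in 𝓝 0, (f i =ᶠ[𝓝 0] f j → f i k = f j k) ∧
      (¬ f i =ᶠ[𝓝 0] f j → k ≠ 0 → f i k ≠ f j k) := by
    intro i j
    by_cases hij : f i =ᶠ[𝓝 0] f j
    · filter_upwards [hij] with k hk using ⟨fun _ => hk, fun h => absurd hij h⟩
    · have h1 := ((hf i).eventually_eq_or_eventually_ne (hf j)).resolve_left hij
      filter_upwards [eventually_nhdsWithin_iff.1 h1] with k hk
      exact ⟨fun h => absurd h hij, fun _ => hk⟩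
  obtain ⟨r, hr, hball⟩ := Metric.eventually_nhds_iff_ball.1
    ((hω.and h).and ((eventually_all.2 fun i => (hf i).eventually_analyticAt).and
      (eventually_all.2 fun i => eventually_all.2 (hdich i))))
  set U : Set ℂ := Metric.ball (0 : ℂ) r \ {0} with hU
  have hUb : ∀ k : U, (k : ℂ) ∈ Metric.ball (0 : ℂ) r := fun k => k.2.1
  have : PreconnectedSpace U := Subtype.preconnectedSpace (isPreconnected_ball_diff_zero r)
  have hωc : Continuous fun k : U => ω k := continuous_iff_continuousAt.2 fun k =>
    (hball k (hUb k)).1.1.comp continuous_subtype_val.continuousAt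
  have hfc : ∀ i, Continuous fun k : U => f i k := fun i => continuous_iff_continuousAt.2 fun k =>
    ((hball k (hUb k)).2.1 i).continuousAt.comp (f := fun k : U => (k : ℂ))
      continuous_subtype_val.continuousAt
  have hk0 : ((r / 2 : ℝ) : ℂ) ∈ U := by
    refine ⟨?_, ?_⟩
    · rw [mem_ball_zero_iff, Complex.norm_real, Real.norm_of_nonneg (by positivity)]
      linarith
    · simpa using hr.ne'
  obtain ⟨i, hi⟩ := (hball _ hk0.1).1.2
  have hcl : IsClosed {k : U | ω k = f i k} := isClosed_eq hωc (hfc i)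
  have hcompl : {k : U | ω k = f i k}ᶜ =
      ⋃ j ∈ {j | ¬ f i =ᶠ[𝓝 0] f j}, {k : U | ω k = f j k} := by
    ext k
    simp only [Set.mem_compl_iff, Set.mem_ofPred_eq, Set.mem_iUnion, exists_prop]
    constructor
    · intro hk
      obtain ⟨j, hj⟩ := (hball k (hUb k)).1.2
      refine ⟨j, fun hij => hk ?_, hj⟩
      rw [hj, ((hball k (hUb k)).2.2 i j).1 hij]
    · rintro ⟨j, hij, hj⟩ hk
      exact ((hball k (hUb k)).2.2 i j).2 hij k.2.2 (hk.symm.trans hj)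
  have hopen : IsOpen {k : U | ω k = f i k} := by
    rw [← isClosed_compl_iff, hcompl]
    exact (Set.toFinite _).isClosed_biUnion fun j _ => isClosed_eq hωc (hfc j)
  have huniv := IsClopen.eq_univ ⟨hcl, hopen⟩ ⟨⟨_, hk0⟩, hi⟩
  refine ⟨i, ?_⟩
  filter_upwards [Metric.ball_mem_nhds (0 : ℂ) hr] with k hk
  by_cases hk' : k = 0
  · rw [hk', hω0, hf0]
  · exact Set.eq_univ_iff_forall.1 huniv ⟨k, hk, hk'⟩

/-! ### Velocity and collision invariants -/

namespace EquilibriumState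

variable (S : EquilibriumState)

theorem velocityOp_symm (φ ψ : S.H) : ⟪φ, S.velocityOp ψ⟫_ℂ = ⟪S.velocityOp φ, ψ⟫_ℂ := by
  rw [L2.inner_def, L2.inner_def]
  refine integral_congr_ae ?_
  filter_upwards [S.velocityOp_apply_ae φ, S.velocityOp_apply_ae ψ] with p h1 h2
  rw [h1, h2]
  simp only [RCLike.inner_apply, map_mul, velocity, Complex.conj_ofReal]
  ring

/-- The density of `S.measure` has no zeros. -/
theorem volume_absolutelyContinuous_measure : (volume : Measure Momentum) ≪ S.measure := by
  have hcf : Continuous S.feq := by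
    have := S.continuous_energy
    unfold feq; fun_prop
  refine withDensity_absolutelyContinuous' (by fun_prop) (ae_of_all _ fun p => ?_)
  have : 0 < S.feq p := Real.exp_pos _
  rw [Ne, ENNReal.ofReal_eq_zero, not_le]
  positivity

theorem linearIndependent_invariant : LinearIndependent ℂ S.invariant := by
  rw [Fintype.linearIndependent_iff]
  intro c hc
  have h1 : (fun p => ∑ i, c i * S.invariantFun i p) =ᵐ[S.measure] fun _ => 0 := by
    have h2 : ∀ᵐ p ∂S.measure, ∀ i, S.invariant i p = S.invariantFun i p :=
      ae_all_iff.2 fun i => (S.memLp_invariantFun i).coeFn_toLp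
    have h3 : ∀ᵐ p ∂S.measure, ∀ i, (c i • S.invariant i) p = c i • S.invariant i p :=
      ae_all_iff.2 fun i => Lp.coeFn_smul _ _
    have h4 := Lp.coeFn_fun_finsetSum Finset.univ fun i => c i • S.invariant i
    rw [hc] at h4
    filter_upwards [h2, h3, h4, Lp.coeFn_zero ℂ 2 S.measure] with p h2 h3 h4 h5
    rw [h5] at h4
    simpa [h2, h3] using h4.symm
  have h6 : (fun p => ∑ i, c i * S.invariantFun i p) = fun _ => 0 :=
    (Continuous.ae_eq_iff_eq volume
      (continuous_finsetSum _ fun i _ => continuous_const.mul (S.continuous_invariantFun i))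
      continuous_const).1 (S.volume_absolutelyContinuous_measure.ae_eq h1)
  have key : ∀ p : Momentum,
      c 0 + c 1 * (S.energy p : ℂ) + c 2 * (p 0 : ℂ) + c 3 * (p 1 : ℂ) + c 4 * (p 2 : ℂ) = 0 := by
    intro p
    have := congrFun h6 p
    simpa [Fin.sum_univ_five, invariantFun] using this
  have henergy : ∀ j : Fin 3, S.energy (EuclideanSpace.single j 1) = √(S.mass ^ 2 + 1) ∧
      S.energy (-EuclideanSpace.single j 1) = √(S.mass ^ 2 + 1) := fun j => by
    simp [energy]
  have hzero : S.energy 0 = S.mass := by simp [energy, Real.sqrt_sq S.mass_nonneg]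
  -- opposite momenta have the same energy, so the even and the odd part vanish separately
  have k0 := key 0
  have k1 := key (EuclideanSpace.single 0 1)
  have k2 := key (-EuclideanSpace.single 0 1)
  have k3 := key (EuclideanSpace.single 1 1)
  have k4 := key (-EuclideanSpace.single 1 1)
  have k5 := key (EuclideanSpace.single 2 1)
  have k6 := key (-EuclideanSpace.single 2 1)
  simp only [henergy, hzero] at k0 k1 k2 k3 k4 k5 k6
  simp at k0 k1 k2 k3 k4 k5 k6
  have hlt : S.mass < √(S.mass ^ 2 + 1) := Real.lt_sqrt_of_sq_lt (by linarith)
  have hne : ((√(S.mass ^ 2 + 1) : ℝ) : ℂ) - (S.mass : ℂ) ≠ 0 := by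
    rw [← Complex.ofReal_sub]
    exact_mod_cast (sub_pos.2 hlt).ne'
  have hc1 : c 1 = 0 := by
    refine (mul_eq_zero.1 ?_).resolve_right hne
    linear_combination (k1 + k2) / 2 - k0
  rw [hc1] at k0 k1 k3 k5 k2 k4 k6
  have hc0 : c 0 = 0 := by linear_combination k0
  have hc2 : c 2 = 0 := by linear_combination (k1 - k2) / 2
  have hc3 : c 3 = 0 := by linear_combination (k3 - k4) / 2
  have hc4 : c 4 = 0 := by linear_combination (k5 - k6) / 2
  intro i
  fin_cases i <;> assumption

end EquilibriumState

/-! ### Dispersion relations and their Taylor series -/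

theorem AnalyticAt.exists_hasSum_taylor {f : ℂ → ℂ} (hf : AnalyticAt ℂ f 0) :
    ∃ r : ℝ, 0 < r ∧ ∀ k ∈ Metric.ball (0 : ℂ) r,
      HasSum (fun n : ℕ => (iteratedDeriv n f 0 / (n.factorial : ℂ)) * k ^ n) (f k) := by
  obtain ⟨r, hr, hball⟩ := Metric.eventually_nhds_iff_ball.1 hf.eventually_analyticAt
  refine ⟨r, hr, fun k hk => ?_⟩
  have h1 : DifferentiableOn ℂ f (Metric.ball 0 r) := fun z hz =>
    (hball z hz).differentiableAt.differentiableWithinAt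
  have h2 := Complex.hasSum_taylorSeries_on_ball h1 hk
  simp only [sub_zero, smul_eq_mul] at h2
  have h3 : (fun n : ℕ => iteratedDeriv n f 0 / (n.factorial : ℂ) * k ^ n) =
      fun n => (n.factorial : ℂ)⁻¹ * (k ^ n * iteratedDeriv n f 0) := by
    funext n
    ring
  rw [h3]
  exact h2

theorem AnalyticOnNhd.exists_hasSum_pow_smul {F : Type*} [NormedAddCommGroup F] [NormedSpace ℂ F]
    [CompleteSpace F] {f : ℂ → F} {R : ℝ} (hf : AnalyticOnNhd ℂ f (Metric.ball 0 R)) :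
    ∃ g : ℕ → F, g 0 = f 0 ∧
      ∀ z ∈ Metric.ball (0 : ℂ) R, HasSum (fun n => z ^ n • g n) (f z) := by
  refine ⟨fun n => (n.factorial : ℂ)⁻¹ • iteratedDeriv n f 0, by simp, fun z hz => ?_⟩
  convert Complex.hasSum_taylorSeries_on_ball hf.differentiableOn hz using 2 with n
  rw [sub_zero, smul_comm]

namespace EquilibriumState

variable {S : EquilibriumState} {I : S.H →ₗ.[ℂ] S.H}

theorem isHydrodynamicDispersion_iff {ι : Type*} [Finite ι] {R δ : ℝ} (hR : 0 < R) (hδ : 0 < δ)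
    {lam : ι → ℂ → ℂ} (h0 : ∀ s, lam s 0 = 0) (hlam : ∀ s, AnalyticAt ℂ (lam s) 0)
    (heig : ∀ χ ∈ Metric.ball (0 : ℂ) R, ∀ s,
      UnboundedOp.HasEigenvalue (UnboundedOp.perturb I S.velocityOp χ) (lam s χ))
    (hspec : ∀ χ ∈ Metric.ball (0 : ℂ) R,
      UnboundedOp.spectrum (UnboundedOp.perturb I S.velocityOp χ) ∩ Metric.ball 0 δ =
        Set.range (fun s => lam s χ)) (ω : ℂ → ℂ) :
    S.IsHydrodynamicDispersion I ω ↔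
      ∃ s, ω =ᶠ[𝓝 0] fun k => -Complex.I * lam s (Complex.I * k) := by
  have hrot : Tendsto (fun k : ℂ => Complex.I * k) (𝓝 0) (𝓝 0) := by
    simpa using (continuous_const_mul Complex.I).tendsto 0
  have hsmall := hrot.eventually (Metric.ball_mem_nhds 0 hR)
  have hf : ∀ s, AnalyticAt ℂ (fun k => -Complex.I * lam s (Complex.I * k)) 0 := fun s =>
    analyticAt_const.mul ((hlam s).comp_of_eq (analyticAt_const.mul analyticAt_id) (by simp))
  constructor
  · intro hω
    refine exists_eventuallyEq_of_continuous_selection hf (fun s => by simp [h0])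
      hω.continuousAt hω.zero ?_
    have h1 : Tendsto (fun k => Complex.I * ω k) (𝓝 0) (𝓝 0) := by
      have := hω.continuousAt.self_of_nhds.tendsto
      rw [hω.zero] at this
      exact hrot.comp this
    filter_upwards [hω.eigenvalue, hsmall, h1.eventually (Metric.ball_mem_nhds 0 hδ)]
      with k hk hkR hkδ
    have h2 : Complex.I * ω k ∈ Set.range fun s => lam s (Complex.I * k) := by
      rw [← hspec _ hkR]
      exact ⟨hk.mem_spectrum, hkδ⟩
    obtain ⟨s, hs⟩ := h2
    refine ⟨s, ?_⟩
    dsimp only at hs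
    rw [hs, ← mul_assoc, neg_mul, Complex.I_mul_I, neg_neg, one_mul]
  · rintro ⟨s, hs⟩
    have hωa := (hf s).congr hs.symm
    refine ⟨hωa.eventually_analyticAt.mono fun k hk => hk.continuousAt, ?_, ?_⟩
    · rw [hs.eq_of_nhds, mul_zero, h0, mul_zero]
    · filter_upwards [hs, hsmall] with k hk hkR
      rw [hk, ← mul_assoc, mul_neg, Complex.I_mul_I, neg_neg, one_mul]
      exact heig _ hkR s

end EquilibriumState

theorem theorem1 (S : EquilibriumState) (A : S.H →ₗ.[ℂ] S.H) (hA : S.IsCollisionOperator A)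
    (I : S.H →ₗ.[ℂ] S.H) (hI : I = UnboundedOp.friedrichs A hA.nonneg)
    (τg : ℝ) (hτg : 0 < τg)
    (hgap : ∀ z ∈ UnboundedOp.spectrum (UnboundedOp.part I S.nonHydroSpace), 1 / τg ≤ z.re) :
    ∃ (R δ : ℝ) (lam : Fin 5 → ℂ → ℂ) (φ : Fin 5 → ℂ → S.H), 0 < R ∧ 0 < δ ∧
      -- five eigenvalues and eigenvectors, given by power series on the disc of radius `R`
      (∀ s, lam s 0 = 0) ∧
      (∀ s, AnalyticOnNhd ℂ (lam s) (Metric.ball 0 R)) ∧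
      (∀ s, AnalyticOnNhd ℂ (φ s) (Metric.ball 0 R)) ∧
      (∀ s, ∃ c : ℕ → ℂ, c 0 = 0 ∧
        ∀ χ ∈ Metric.ball (0 : ℂ) R, HasSum (fun n => c n * χ ^ n) (lam s χ)) ∧
      (∀ s, ∃ g : ℕ → S.H,
        ∀ χ ∈ Metric.ball (0 : ℂ) R, HasSum (fun n => χ ^ n • g n) (φ s χ)) ∧
      (∀ χ ∈ Metric.ball (0 : ℂ) R,
        LinearIndependent ℂ (fun s => φ s χ) ∧
        (∀ s, ∃ h : φ s χ ∈ (UnboundedOp.perturb I S.velocityOp χ).domain,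
          UnboundedOp.perturb I S.velocityOp χ ⟨φ s χ, h⟩ = lam s χ • φ s χ) ∧
        -- these are all the eigenvalues near `0`, with their multiplicities
        UnboundedOp.spectrum (UnboundedOp.perturb I S.velocityOp χ) ∩ Metric.ball 0 δ =
          Set.range (fun s => lam s χ) ∧
        ∀ z ∈ Metric.ball (0 : ℂ) δ, ∀ ψ : (UnboundedOp.perturb I S.velocityOp χ).domain,
          UnboundedOp.perturb I S.velocityOp χ ψ = z • (ψ : S.H) ↔
            (ψ : S.H) ∈ Submodule.span ℂ ((fun s => φ s χ) '' {s | lam s χ = z})) ∧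
      -- the hydrodynamic dispersion relations are the five functions `-i λ_s (i k)` near `k = 0`
      (∀ ω : ℂ → ℂ, S.IsHydrodynamicDispersion I ω ↔
        ∃ s, ω =ᶠ[𝓝 0] fun k => -Complex.I * lam s (Complex.I * k)) ∧
      -- each of them is the sum of its Taylor series, with a nonzero radius of convergence
      (∀ ω : ℂ → ℂ, S.IsHydrodynamicDispersion I ω →
        ∃ r : ℝ, 0 < r ∧ ∀ k ∈ Metric.ball (0 : ℂ) r,
          HasSum (fun n : ℕ => (iteratedDeriv n ω 0 / (n.factorial : ℂ)) * k ^ n) (ω k)) := by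
  have hAsymm : A.IsFormalAdjoint A := fun x y => by
    rw [← hA.hermitian y x, inner_conj_symm]
  have hIsymm : ∀ x y : I.domain, ⟪(x : S.H), I y⟫_ℂ = ⟪I x, (y : S.H)⟫_ℂ := by
    subst hI
    exact UnboundedOp.friedrichs_symm hA.dense hAsymm hA.nonneg
  have hker : ∀ x ∈ S.hydroSpace, ∃ h : x ∈ I.domain, I ⟨x, h⟩ = 0 := by
    intro x hx
    obtain ⟨h1, h2⟩ := (hA.ker x).2 hx
    subst hI
    obtain ⟨h3, h4⟩ := UnboundedOp.friedrichs_extends hA.dense hAsymm hA.nonneg ⟨x, h1⟩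
    exact ⟨h3, h4.trans h2⟩
  have h0 : 0 ∈ UnboundedOp.resolventSet (UnboundedOp.part I S.hydroSpaceᗮ) := by
    by_contra h
    have := hgap 0 h
    rw [Complex.zero_re] at this
    exact absurd this (not_le.2 (by positivity))
  have : FiniteDimensional ℂ S.hydroSpace := FiniteDimensional.span_of_finite ℂ (Set.finite_range _)
  have hrank : Module.finrank ℂ S.hydroSpace = 5 :=
    (finrank_span_eq_card S.linearIndependent_invariant).trans (Fintype.card_fin 5)
  obtain ⟨Q, hQ⟩ := UnboundedOp.exists_isReducedInverse hIsymm hker h0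
  have hmain := hQ.exists_analytic_eigenvectors (N := S.hydroSpace) (V := S.velocityOp)
    (fun x => Submodule.starProjection_apply_mem _ x)
    (fun x hx => Submodule.starProjection_eq_self_iff.2 hx) hIsymm S.velocityOp_symm
  rw [hrank] at hmain
  obtain ⟨R, δ, lam, φ, hR, hδ, hlam0, hlam, hφ, hχ⟩ := hmain
  have hlamAt : ∀ s, AnalyticAt ℂ (lam s) 0 := fun s => hlam s 0 (Metric.mem_ball_self hR)
  have hiff := S.isHydrodynamicDispersion_iff (I := I) hR hδ hlam0 hlamAt
    (fun χ h s => by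
      obtain ⟨hind, heig, -⟩ := hχ χ h
      exact ⟨⟨_, (heig s).1⟩, hind.ne_zero s, (heig s).2⟩)
    (fun χ h => (hχ χ h).2.2.1)
  refine ⟨R, δ, lam, φ, hR, hδ, hlam0, hlam, hφ, fun s => ?_, fun s => ?_, hχ, hiff,
    fun ω hω => ?_⟩
  · obtain ⟨c, hc0, hc⟩ := (hlam s).exists_hasSum_pow_smul
    refine ⟨c, hc0.trans (hlam0 s), fun χ h => ?_⟩
    simpa only [smul_eq_mul, mul_comm] using hc χ h
  · obtain ⟨g, -, hg⟩ := (hφ s).exists_hasSum_pow_smul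
    exact ⟨g, hg⟩
  · obtain ⟨s, hs⟩ := (hiff ω).1 hω
    refine AnalyticAt.exists_hasSum_taylor (AnalyticAt.congr ?_ hs.symm)
    exact analyticAt_const.mul
      ((hlamAt s).comp_of_eq (analyticAt_const.mul analyticAt_id) (by simp))
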